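/- Let $k$ be an algebraically closed field of characteristic $0$, $T=(k^\times)^n$ with character lattice $\mathfrak X(T)=\mathbb Z^n$, and $\mathbb X$ an irreducible affine variety over $k$ with an action of $T$. For $\chi\in\mathfrak X(T)$ let $k[\mathbb X]_\chi$ be the space of regular functions of weight $\chi$, let $\Sigma_{\mathbb X}=\{\chi : k[\mathbb X]_\chi\ne 0\}$, and let $\widehat\Sigma_{\mathbb X}=\{\chi : r\chi\in\Sigma_{\mathbb X}\text{ for some integer } r>0\}$. For a $k$-scheme $S$, let $\mathcal M_{\mathbb X,T}(S)$ be the category of families of affine stable toric $T$-varieties over $\mathbb X$ with base $S$: $T$-schemes $X$ with an affine $T$-invariant morphism $p_S:X\to S$ of finite type and a $T$-equivariant morphism $p_{\mathbb X}:X\to\mathbb X$ of $k$-schemes such that, with $\mathcal F=(p_S)_*\mathcal O_X$, the weight subsheaf $\mathcal F_\chi$ is locally free of rank $1$ for $\chi\in\widehat\Sigma_{\mathbb X}$ and of rank $0$ otherwise, the geometric fibers $X_s$ of $p_S$ are reduced, and $p_S\times p_{\mathbb X}:X\to S\times\mathbb X$ is finite. Morphisms are the $T$-equivariant morphisms over $S$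 and over $\mathbb X$. Write $\mathcal M_{\mathbb X,T}(k)$ for $S=\operatorname{Spec}k$. Let $A=\{\chi_1,\dots,\chi_d\}\subset\widehat\Sigma_{\mathbb X}$ be a finite subset with $d$ elements and $N$ a positive integer such that, for every family of affine stable toric $T$-varieties over $\mathbb X$ with any base $S$, the $\mathcal O_S$-algebra $\mathcal F$ is generated by the $\mathcal F_\chi$ with $\chi\in A$, and $\mathcal O_S\otimes k[\mathbb X]_{N\chi}\to\mathcal F_{N\chi}$ is surjective for all $\chi\in\widehat\Sigma_{\mathbb X}$. Put $\mathbb T=(k^\times)^d$, let $\alpha:\mathfrak X(\mathbb T)=\mathbb Z^d\to\mathfrak X(T)$ be the homomorphism that sends the $i$-th basis vector to $\chi_i$, and, for a subset $\Sigma\subset\mathfrak X(T)$, let $\mathbb Z^{A\cap\Sigma}\subset\mathbb Z^d$ be spanned by the basis vectors with $\chi_i\in\Sigma$. For $K\supseteq k$ an algebraically closed field and a $K$-scheme $Y$ with a $T$-action and a $T$-equivariant morphism to $\mathbb X$, let $\Sigma_Z$ be the set of weights of $K[Z]$ for an irreducible component $Z$ of $Y$ (with its reduced structure), and let $\Gamma_Y\subset\mathbb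 T(K)$ be the subgroup of the $t$ such that 1. for every irreducible component $Z$ of $Y$, the characters in the kernel of $\alpha|_{\mathbb Z^{A\cap\Sigma_Z}}$ are trivial at $t$; 2. for every $\chi\in\Sigma_{\mathbb X}$ such that the image of $k[\mathbb X]_\chi$ in $K[Y]_\chi$ is non-zero, and every irreducible component $Z$ of $Y$ with $\chi\in\Sigma_Z$, the characters in $(\alpha|_{\mathbb Z^{A\cap\Sigma_Z}})^{-1}(\chi)$ are trivial at $t$. **(a)** Let $Y\in\mathcal M_{\mathbb X,T}(k)$. Every automorphism $g$ of $Y$ multiplies $k[Y]_\chi$ by a scalar $\psi(\chi)\in k^\times$ for each $\chi\in\widehat\Sigma_{\mathbb X}$. A map $\psi:\widehat\Sigma_{\mathbb X}\to k^\times$ arises in this way from an automorphism if and only if its restriction to $\Sigma_Z$ is a homomorphism of monoids for every irreducible component $Z$ of $Y$, and $\psi(\chi)=1$ whenever the image of $k[\mathbb X]_\chi$ in $k[Y]_\chi$ is non-zero. The map $g\mapsto(\psi(\chi_1),\dots,\psi(\chi_d))$ is an isomorphism from $\operatorname{Aut}(Y)$ onto $\Gamma_Y\subset\mathbb T$. If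 $Y$ is irreducible, condition 1 means that $t$ lies in the image of $T\to\mathbb T$, $\tau\mapsto(\chi_1(\tau),\dots,\chi_d(\tau))$. For every $\chi\in\mathfrak X(\mathbb T)$ the character $N\chi$ is trivial on $\Gamma_Y$, and $\Gamma_Y$ is finite. **(b)** Let $S$ be a $k$-scheme and $X\in\mathcal M_{\mathbb X,T}(S)$. There is an injective homomorphism from $\operatorname{Aut}(X)$ to the group $\operatorname{Mor}(S,\mathbb T)$ of $S$-points of $\mathbb T$, $g\mapsto(t_1,\dots,t_d)$, such that $g^*$ acts on $\mathcal F_{\chi_i}$ as multiplication by $t_i$. Its image is killed by $N$ and is contained in the group $\Gamma_X$ of those $t\in\operatorname{Mor}(S,\mathbb T)$ such that $t(s)\in\Gamma_{X_s}$ for every geometric point $s$ of $S$. If $S$ is reduced, the image is all of $\Gamma_X$, so $\operatorname{Aut}(X)\cong\Gamma_X$. -/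

import Mathlib

open CategoryTheory CategoryTheory.Limits AlgebraicGeometry

universe u

noncomputable section

namespace StableToric

/-! ### Tori and torus actions -/

/-- The group of `W`-points of the split torus with coordinates indexed by `ι`:
tuples of invertible global functions on `W`. -/
abbrev TorusPoints (ι : Type) (W : Scheme.{u}) : Type u := ι → Γ(W, ⊤)ˣ

/-- Pullback of points of a torus along a morphism `W' ⟶ W`. -/
def TorusPoints.pull {ι : Type} {W' W : Scheme.{u}} (f : W' ⟶ W) :
    TorusPoints ι W →* TorusPoints ι W' where
  toFun t i := Units.map (f.appTop.hom : Γ(W, ⊤) →* Γ(W', ⊤)) (t i)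
  map_one' := by ext i; simp
  map_mul' t t' := by ext i; simp

/-- The value at `t` of the character with exponents `m`: the monomial `∏ tᵢ ^ mᵢ`. -/
def charEval {ι : Type} [Fintype ι] {G : Type*} [CommGroup G] (m : ι → ℤ) (t : ι → G) : G :=
  ∏ i, t i ^ m i

/-- An action of the `n`-dimensional split torus on a scheme `X`, given on the functor of
points: the group of `W`-points of the torus acts on the set of `W`-points of `X`, naturally
in `W`. -/
structure TorusAction (n : ℕ) (X : Scheme.{u}) where
  act : ∀ {W : Scheme.{u}}, TorusPoints (Fin n) W → (W ⟶ X) → (W ⟶ X)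
  one_act : ∀ {W : Scheme.{u}} (x : W ⟶ X), act 1 x = x
  mul_act : ∀ {W : Scheme.{u}} (t t' : TorusPoints (Fin n) W) (x : W ⟶ X),
    act (t * t') x = act t (act t' x)
  comp_act : ∀ {W' W : Scheme.{u}} (f : W' ⟶ W) (t : TorusPoints (Fin n) W) (x : W ⟶ X),
    f ≫ act t x = act (TorusPoints.pull f t) (f ≫ x)

/-- For a torus-stable open subset `V` of `X`, the group of semi-invariant functions of weight
`χ` on `V`: the `f` with `f (t • x) = χ(t) f(x)` for all points `t` of the torus and `x` of `V`. -/
def TorusAction.weightSpace {n : ℕ} {X : Scheme.{u}} (a : TorusAction n X) (V : X.Opens)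
    (χ : Fin n → ℤ) : AddSubgroup Γ(X, V) where
  carrier := {f | ∀ (W : Scheme.{u}) (t : TorusPoints (Fin n) W) (x : W ⟶ X)
    (hx : ⊤ ≤ x ⁻¹ᵁ V) (htx : ⊤ ≤ (a.act t x) ⁻¹ᵁ V),
    (a.act t x).appLE V ⊤ htx f = (charEval χ t : Γ(W, ⊤)ˣ) * x.appLE V ⊤ hx f}
  zero_mem' := by intro W t x hx htx; simp
  add_mem' := by
    intro f g hf hg W t x hx htx
    rw [map_add, map_add, hf W t x hx htx, hg W t x hx htx, mul_add]
  neg_mem' := by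
    intro f hf W t x hx htx
    rw [map_neg, map_neg, hf W t x hx htx, mul_neg]

/-- The weights of the functions on the reduced closed subscheme of `X` supported on a
torus-stable closed set `Z`: those `χ` for which some global function of weight `χ` has a
non-zero restriction to `Z`. -/
def TorusAction.weightSet {n : ℕ} {X : Scheme.{u}} (a : TorusAction n X) (Z : Set X) :
    Set (Fin n → ℤ) :=
  {χ | ∃ f ∈ a.weightSpace ⊤ χ, ∃ z ∈ Z, z ∈ X.basicOpen f}

/-- Given an action on `X` and a morphism `p : X ⟶ S` invariant under it, the induced action on
the base change of `X` along `s : S' ⟶ S`. -/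
def TorusAction.baseChange {n : ℕ} {X S S' : Scheme.{u}} (a : TorusAction n X) (p : X ⟶ S)
    (hp : ∀ {W : Scheme.{u}} (t : TorusPoints (Fin n) W) (x : W ⟶ X), a.act t x ≫ p = x ≫ p)
    (s : S' ⟶ S) : TorusAction n (pullback p s) where
  act t x := pullback.lift (a.act t (x ≫ pullback.fst p s)) (x ≫ pullback.snd p s)
    (by rw [hp, Category.assoc, Category.assoc, pullback.condition])
  one_act x := by
    apply pullback.hom_ext
    · rw [pullback.lift_fst, a.one_act]
    · rw [pullback.lift_snd]
  mul_act t t' x := by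
    apply pullback.hom_ext
    · rw [pullback.lift_fst, pullback.lift_fst, pullback.lift_fst, a.mul_act]
    · rw [pullback.lift_snd, pullback.lift_snd, pullback.lift_snd]
  comp_act f t x := by
    apply pullback.hom_ext
    · rw [Category.assoc, pullback.lift_fst, pullback.lift_fst, a.comp_act, Category.assoc]
    · rw [Category.assoc, pullback.lift_snd, pullback.lift_snd, Category.assoc]

/-! ### The variety `𝕏` -/

/-- An irreducible affine variety over `k` with an action of the torus `(k^×)^n`. -/
structure IrredAffineTVariety (k : Type u) [Field k] (n : ℕ) where
  X : Scheme.{u}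
  str : X ⟶ Spec (.of k)
  isAffine : IsAffine X
  isIntegral : IsIntegral X
  finiteType : LocallyOfFiniteType str
  action : TorusAction n X
  action_str : ∀ {W : Scheme.{u}} (t : TorusPoints (Fin n) W) (x : W ⟶ X),
    action.act t x ≫ str = x ≫ str

section Variety

variable {k : Type u} [Field k] {n : ℕ}

/-- The weight monoid `Σ_𝕏`. -/
def IrredAffineTVariety.weightMonoid (𝕏 : IrredAffineTVariety k n) : Set (Fin n → ℤ) :=
  {χ | ∃ f ∈ 𝕏.action.weightSpace ⊤ χ, f ≠ 0}

/-- The saturation of the weight monoid. -/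
def IrredAffineTVariety.saturation (𝕏 : IrredAffineTVariety k n) : Set (Fin n → ℤ) :=
  {χ | ∃ r : ℕ, 0 < r ∧ r • χ ∈ 𝕏.weightMonoid}

/-! ### Families -/

/-- For a scheme `X` with a torus action and an invariant morphism `p : X ⟶ S`, the subsheaf of
weight `χ` of `p_* 𝒪_X` is a locally free `𝒪_S`-module of rank `r`: around every point of `S`
it has `r` sections that form a basis over every smaller open set. -/
def IsLocallyFreeOfRank {X S : Scheme.{u}} (a : TorusAction n X) (p : X ⟶ S)
    (χ : Fin n → ℤ) (r : ℕ) : Prop :=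
  ∀ s : S, ∃ (U : S.Opens) (_ : s ∈ U) (e : Fin r → Γ(X, p ⁻¹ᵁ U)),
    (∀ j, e j ∈ a.weightSpace (p ⁻¹ᵁ U) χ) ∧
    ∀ (V : S.Opens) (hVU : V ≤ U), ∀ f ∈ a.weightSpace (p ⁻¹ᵁ V) χ,
      ∃! c : Fin r → Γ(S, V), f = ∑ j, p.app V (c j) *
        X.presheaf.map (homOfLE (p.preimage_mono hVU)).op (e j)

/-- A family of affine `T`-schemes over `S` with Hilbert function `h`. -/
structure IsAffineFamily {X S : Scheme.{u}} (a : TorusAction n X) (p : X ⟶ S)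
    (h : (Fin n → ℤ) → ℕ) : Prop where
  isAffineHom : IsAffineHom p
  finiteType : LocallyOfFiniteType p
  invariant : ∀ {W : Scheme.{u}} (t : TorusPoints (Fin n) W) (x : W ⟶ X),
    a.act t x ≫ p = x ≫ p
  locallyFree : ∀ χ, IsLocallyFreeOfRank a p χ (h χ)

open Classical in
/-- The function with value `1` on `Σ` and `0` elsewhere. -/
def hilbertFunction (Sig : Set (Fin n → ℤ)) (χ : Fin n → ℤ) : ℕ := if χ ∈ Sig then 1 else 0

/-- A family of affine stable toric `T`-varieties over `𝕏` with base the `k`-scheme `S`. -/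
structure StableToricFamily (𝕏 : IrredAffineTVariety k n) {S : Scheme.{u}}
    (strS : S ⟶ Spec (.of k)) where
  X : Scheme.{u}
  action : TorusAction n X
  pS : X ⟶ S
  pX : X ⟶ 𝕏.X
  over_k : pS ≫ strS = pX ≫ 𝕏.str
  equivariant : ∀ {W : Scheme.{u}} (t : TorusPoints (Fin n) W) (x : W ⟶ X),
    action.act t x ≫ pX = 𝕏.action.act t (x ≫ pX)
  isFamily : IsAffineFamily action pS (hilbertFunction 𝕏.saturation)
  reduced : ∀ (K : Type u) [Field K] [IsAlgClosed K] (s : Spec (.of K) ⟶ S),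
    AlgebraicGeometry.IsReduced (pullback pS s)
  finite : IsFinite (pullback.lift pS pX over_k : X ⟶ pullback strS 𝕏.str)

namespace StableToricFamily

variable {𝕏 : IrredAffineTVariety k n} {S : Scheme.{u}} {strS : S ⟶ Spec (.of k)}

/-- Morphisms between families over the same base `S`, inducing the identity of `S`. -/
@[ext]
structure Hom (X X' : StableToricFamily 𝕏 strS) where
  hom : X.X ⟶ X'.X
  equivariant : ∀ {W : Scheme.{u}} (t : TorusPoints (Fin n) W) (x : W ⟶ X.X),
    X.action.act t x ≫ hom = X'.action.act t (x ≫ hom)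
  comp_pS : hom ≫ X'.pS = X.pS
  comp_pX : hom ≫ X'.pX = X.pX

/-- The category `ℳ_{𝕏,T}(S)`. -/
instance : Category (StableToricFamily 𝕏 strS) where
  Hom := Hom
  id X := ⟨𝟙 X.X, by simp, by simp, by simp⟩
  comp f g := ⟨f.hom ≫ g.hom,
    by intro W t x; rw [← Category.assoc, f.equivariant, g.equivariant, Category.assoc],
    by rw [Category.assoc, g.comp_pS, f.comp_pS],
    by rw [Category.assoc, g.comp_pX, f.comp_pX]⟩
  id_comp f := by apply Hom.ext; simp
  comp_id f := by apply Hom.ext; simp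
  assoc f g h := by apply Hom.ext; simp

/-- For an open set `U` of the base, the functions of weight `χ` on the preimage of `U`: the
sections over `U` of the sheaf `ℱ_χ`. -/
def sections (X : StableToricFamily 𝕏 strS) (U : S.Opens) (χ : Fin n → ℤ) :
    AddSubgroup Γ(X.X, X.pS ⁻¹ᵁ U) :=
  X.action.weightSpace (X.pS ⁻¹ᵁ U) χ

/-- The effect `g^*` of an automorphism `g` on functions on the preimage of `U ⊆ S`. -/
def pullAut {X : StableToricFamily 𝕏 strS} (g : Aut X) (U : S.Opens) :
    Γ(X.X, X.pS ⁻¹ᵁ U) →+* Γ(X.X, X.pS ⁻¹ᵁ U) :=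
  ((Hom.hom g.hom).appLE (X.pS ⁻¹ᵁ U) (X.pS ⁻¹ᵁ U)
    (by rw [← Scheme.Hom.comp_preimage, Hom.comp_pS])).hom

end StableToricFamily

/-! ### The choice of `A` and `N` -/

/-- `A` is a finite subset of the saturation of `Σ_𝕏` and `N` a positive integer such that, for
every family over `𝕏` with any base `S`, the `𝒪_S`-algebra `ℱ = (p_S)_* 𝒪_X` is generated by the
`ℱ_χ` with `χ ∈ A`, and `𝒪_S ⊗ k[𝕏]_{Nχ} ⟶ ℱ_{Nχ}` is surjective for all `χ` in the saturation. As
these sheaves are quasi-coherent, both are expressed over the affine open subsets of `S`. -/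
structure IsAdmissible (𝕏 : IrredAffineTVariety k n) (A : Finset (Fin n → ℤ)) (N : ℕ) :
    Prop where
  subset : (A : Set (Fin n → ℤ)) ⊆ 𝕏.saturation
  pos : 0 < N
  generates : ∀ {S : Scheme.{u}} (strS : S ⟶ Spec (.of k)) (X : StableToricFamily 𝕏 strS)
    (U : S.Opens), IsAffineOpen U →
    Subring.closure (Set.range (X.pS.app U) ∪ {f | ∃ χ ∈ A, f ∈ X.sections U χ}) = ⊤
  surjective : ∀ {S : Scheme.{u}} (strS : S ⟶ Spec (.of k)) (X : StableToricFamily 𝕏 strS)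
    (U : S.Opens), IsAffineOpen U → ∀ χ ∈ 𝕏.saturation, ∀ f ∈ X.sections U (N • χ),
    f ∈ AddSubgroup.closure {b | ∃ (c : Γ(S, U)), ∃ g ∈ 𝕏.action.weightSpace ⊤ (N • χ),
      b = X.pS.app U c * X.pX.appLE ⊤ (X.pS ⁻¹ᵁ U) le_top g}

/-! ### The groups `Γ` -/

/-- The lattice homomorphism `α` from the character lattice `ℤ^A` of the big torus `(k^×)^A` to
the character lattice `ℤ^n` of `T` that sends the basis vector with index `χ ∈ A` to `χ`. -/
def latticeMap (A : Finset (Fin n → ℤ)) : (A → ℤ) →+ (Fin n → ℤ) where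
  toFun m := ∑ χ : A, m χ • χ.1
  map_zero' := by simp
  map_add' m m' := by simp [add_smul, Finset.sum_add_distrib]

/-- The sublattice `ℤ^{A ∩ Sig}` of `ℤ^A`. -/
def subLattice (A : Finset (Fin n → ℤ)) (Sig : Set (Fin n → ℤ)) : AddSubgroup (A → ℤ) where
  carrier := {m | ∀ χ : A, χ.1 ∉ Sig → m χ = 0}
  zero_mem' := by intro χ _; rfl
  add_mem' := by intro m m' h h' χ hχ; simp [h χ hχ, h' χ hχ]
  neg_mem' := by intro m h χ hχ; simp [h χ hχ]

/-- The image of `k[𝕏]_χ` in the functions on `Y` is non-zero. -/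
def HasNonzeroImage (𝕏 : IrredAffineTVariety k n) {Y : Scheme.{u}} (q : Y ⟶ 𝕏.X)
    (χ : Fin n → ℤ) : Prop :=
  ∃ f ∈ 𝕏.action.weightSpace ⊤ χ, q.appTop f ≠ 0

/-- First condition: for every irreducible component `Z` of `Y`, the characters in the kernel of
the restriction of `α` to `ℤ^{A ∩ Σ_Z}` are trivial on `t`. -/
def KernelCondition {Y : Scheme.{u}} (b : TorusAction n Y) (A : Finset (Fin n → ℤ))
    {K : Type u} [Field K] (t : A → Kˣ) : Prop :=
  ∀ Z ∈ irreducibleComponents Y, ∀ m ∈ subLattice A (b.weightSet Z),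
    latticeMap A m = 0 → charEval m t = 1

/-- Second condition: if `k[𝕏]_χ` has a non-zero image in the functions on `Y`, then, for every
irreducible component `Z` of `Y` with `χ ∈ Σ_Z`, the characters in the preimage of `χ` under the
restriction of `α` to `ℤ^{A ∩ Σ_Z}` are trivial on `t`. -/
def WeightCondition (𝕏 : IrredAffineTVariety k n) {Y : Scheme.{u}} (b : TorusAction n Y)
    (q : Y ⟶ 𝕏.X) (A : Finset (Fin n → ℤ)) {K : Type u} [Field K] (t : A → Kˣ) : Prop :=
  ∀ χ ∈ 𝕏.weightMonoid, HasNonzeroImage 𝕏 q χ →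
    ∀ Z ∈ irreducibleComponents Y, χ ∈ b.weightSet Z →
      ∀ m ∈ subLattice A (b.weightSet Z), latticeMap A m = χ → charEval m t = 1

lemma charEval_one {ι : Type} [Fintype ι] {G : Type*} [CommGroup G] (m : ι → ℤ) :
    charEval m (1 : ι → G) = 1 := by
  simp [charEval]

lemma charEval_mul {ι : Type} [Fintype ι] {G : Type*} [CommGroup G] (m : ι → ℤ)
    (t t' : ι → G) : charEval m (t * t') = charEval m t * charEval m t' := by
  simp [charEval, mul_zpow, Finset.prod_mul_distrib]

lemma charEval_inv {ι : Type} [Fintype ι] {G : Type*} [CommGroup G] (m : ι → ℤ)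
    (t : ι → G) : charEval m t⁻¹ = (charEval m t)⁻¹ := by
  simp [charEval, Finset.prod_inv_distrib]

/-- The group `Γ_Y ⊆ (K^×)^A` of a scheme `Y` over the field `K` with an action of `T` and an
equivariant morphism `q` to `𝕏`. -/
def gammaGroup (𝕏 : IrredAffineTVariety k n) {Y : Scheme.{u}} (b : TorusAction n Y)
    (q : Y ⟶ 𝕏.X) (A : Finset (Fin n → ℤ)) (K : Type u) [Field K] : Subgroup (A → Kˣ) where
  carrier := {t | KernelCondition b A t ∧ WeightCondition 𝕏 b q A t}
  one_mem' := ⟨fun _ _ _ _ _ => charEval_one _, fun _ _ _ _ _ _ _ _ _ => charEval_one _⟩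
  mul_mem' := by
    rintro t t' ⟨h1, h2⟩ ⟨h1', h2'⟩
    refine ⟨fun Z hZ m hm h0 => ?_, fun χ hχ hi Z hZ hχZ m hm h0 => ?_⟩
    · rw [charEval_mul, h1 Z hZ m hm h0, h1' Z hZ m hm h0, one_mul]
    · rw [charEval_mul, h2 χ hχ hi Z hZ hχZ m hm h0, h2' χ hχ hi Z hZ hχZ m hm h0, one_mul]
  inv_mem' := by
    rintro t ⟨h1, h2⟩
    refine ⟨fun Z hZ m hm h0 => ?_, fun χ hχ hi Z hZ hχZ m hm h0 => ?_⟩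
    · rw [charEval_inv, h1 Z hZ m hm h0, inv_one]
    · rw [charEval_inv, h2 χ hχ hi Z hZ hχZ m hm h0, inv_one]

/-- The group `Γ_Y ⊆ (k^×)^A` of an object `Y` of `ℳ_{𝕏,T}(k)`. -/
def StableToricFamily.gamma {𝕏 : IrredAffineTVariety k n}
    (Y : StableToricFamily 𝕏 (𝟙 (Spec (.of k)))) (A : Finset (Fin n → ℤ)) :
    Subgroup (A → kˣ) :=
  gammaGroup 𝕏 Y.action Y.pX A k

/-- The `K`-point `t(s)` of a torus given by an `S`-point `t` and a geometric point `s` of `S`. -/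
def evalAt {ι : Type} {S : Scheme.{u}} {K : Type u} [Field K] (s : Spec (.of K) ⟶ S) :
    TorusPoints ι S →* (ι → Kˣ) where
  toFun t i := Units.map ((s.appTop ≫ (Scheme.ΓSpecIso (.of K)).hom).hom : Γ(S, ⊤) →* K) (t i)
  map_one' := by ext i; simp
  map_mul' t t' := by ext i; simp

/-- The group `Γ_X` of a family `X` with base `S`: the `S`-points `t` of the big torus such that
`t(s)` lies in `Γ_{X_s}` for every geometric point `s` of `S`. -/
def StableToricFamily.gammaFamily {𝕏 : IrredAffineTVariety k n} {S : Scheme.{u}}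
    {strS : S ⟶ Spec (.of k)} (X : StableToricFamily 𝕏 strS) (A : Finset (Fin n → ℤ)) :
    Subgroup (TorusPoints A S) where
  carrier := {t | ∀ (K : Type u) [Field K] [IsAlgClosed K] (s : Spec (.of K) ⟶ S),
    evalAt s t ∈ gammaGroup 𝕏 (X.action.baseChange X.pS X.isFamily.invariant s)
      (pullback.fst X.pS s ≫ X.pX) A K}
  one_mem' := by intro K _ _ s; rw [map_one]; exact one_mem _
  mul_mem' := by
    intro t t' h h' K _ _ s
    rw [map_mul]; exact mul_mem (h K s) (h' K s)
  inv_mem' := by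
    intro t h K _ _ s
    rw [map_inv]; exact inv_mem (h K s)

/-- The constant function on `Y` with value `c ∈ k`. -/
def StableToricFamily.const {𝕏 : IrredAffineTVariety k n}
    (Y : StableToricFamily 𝕏 (𝟙 (Spec (.of k)))) (c : k) : Γ(Y.X, Y.pS ⁻¹ᵁ ⊤) :=
  Y.pS.appTop ((Scheme.ΓSpecIso (.of k)).inv c)

/-- The automorphism `g` of `Y` multiplies the functions of weight `χ` by `ψ(χ)`, for all `χ`
in the saturation of `Σ_𝕏`. -/
def StableToricFamily.ActsBy {𝕏 : IrredAffineTVariety k n}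
    {Y : StableToricFamily 𝕏 (𝟙 (Spec (.of k)))} (g : Aut Y) (ψ : 𝕏.saturation → kˣ) : Prop :=
  ∀ χ : 𝕏.saturation, ∀ f ∈ Y.sections ⊤ χ.1,
    StableToricFamily.pullAut g ⊤ f = Y.const (ψ χ : k) * f

/-- The restriction of `ψ` to `Sig` is a homomorphism of monoids. -/
def IsMonoidHomOn {Sat : Set (Fin n → ℤ)} (ψ : Sat → kˣ) (Sig : Set (Fin n → ℤ)) : Prop :=
  (∀ χ : Sat, χ.1 = 0 → ψ χ = 1) ∧
  ∀ χ₁ χ₂ χ₃ : Sat, χ₁.1 ∈ Sig → χ₂.1 ∈ Sig → χ₃.1 = χ₁.1 + χ₂.1 → ψ χ₃ = ψ χ₁ * ψ χ₂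

end Variety

end StableToric

end

/-!
# Automorphism groups of families of affine stable toric varieties
-/

noncomputable section

namespace StableToric

/-! ### Morphisms into affine open subsets -/

section AffineTargets

variable {W W' X : Scheme.{u}} {V : X.Opens}

/-! An automorphism `g` of a family preserves each rank one sheaf `ℱ_χ`, so it acts there through a
unit of the base (`existsUnique_multiplier`). As the `ℱ_χ` with `χ ∈ A` generate `ℱ`, these units
determine `g`, which embeds `Aut X` into the points of the big torus (`multiplierHom_injective`).

Two constraints bound the image. On a component `Z` of a geometric fibre, functions with non-zero
restrictions have a product with non-zero restriction, so the scalars are multiplicative in the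
weights from `Σ_Z` (`character_add`). Functions pulled back from `𝕏` are fixed, so the scalar is `1`
wherever such a function survives (`character_eq_one`). Both together say that the point lies in `Γ`
of the fibre (`mem_gammaGroup_of_isMonoidHomOn`). Pulled back functions also generate `ℱ_{Nχ}`, and
reducedness of the fibres makes the `N`-th power of a generator of `ℱ_χ` a generator of `ℱ_{Nχ}`, so
every multiplier is an `N`-th root of unity (`multiplier_pow_eq_one`).

Conversely, let `t` lie in `Γ` fibrewise over a reduced base. Condition 1 and the divisibility of
`K^×` make scaling by `t` on each component of a geometric fibre a translation by some point of `T`,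
hence compatible with multiplication; by condition 2 this translation fixes what comes from `𝕏`
(`exists_charEval_eq`). Since the base and the fibres are reduced, a function is zero once it
vanishes on all these components (`eq_zero_of_restr_eq_zero`). Thus scaling the generators by `t`
respects all their relations and gives a ring endomorphism over each affine open set
(`exists_scaling`); these glue (`exists_hom_of_ringHom`), and `t⁻¹` gives the inverse.

Over `Spec k`, `Y` is its own geometric fibre, and `A ∩ Σ_Z` generates `Σ_Z` as a group
(`exists_latticeMap_eq`), so `ψ` is determined by its values on `A`.

Actions are given on functors of points; the passage to weight decompositions is by the coaction,
that is, the action of the universal point. -/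

lemma appLE_comp_apply {Y : Scheme.{u}} (f : W ⟶ X) (g : X ⟶ Y) {U : Y.Opens} {W₀ : W.Opens}
    (hV : V ≤ g ⁻¹ᵁ U) (hW : W₀ ≤ f ⁻¹ᵁ V) (h : W₀ ≤ (f ≫ g) ⁻¹ᵁ U) (b : Γ(Y, U)) :
    (f ≫ g).appLE U W₀ h b = f.appLE V W₀ hW (g.appLE U V hV b) := by
  rw [← CategoryTheory.comp_apply, Scheme.Hom.appLE_comp_appLE]

lemma top_le_preimage_top (f : W ⟶ X) : ⊤ ≤ f ⁻¹ᵁ ⊤ := le_top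

lemma appLE_top (f : W ⟶ X) (h : ⊤ ≤ f ⁻¹ᵁ ⊤) : f.appLE ⊤ ⊤ h = f.appTop :=
  f.appLE_eq_app

lemma hom_ext_of_isAffineOpen (hV : IsAffineOpen V) {x y : W ⟶ X} (hx : ⊤ ≤ x ⁻¹ᵁ V)
    (hy : ⊤ ≤ y ⁻¹ᵁ V) (h : x.appLE V ⊤ hx = y.appLE V ⊤ hy) : x = y := by
  have key : ∀ (z : W ⟶ X) (hz : ⊤ ≤ z ⁻¹ᵁ V),
      z = W.toSpecΓ ≫ Spec.map (z.appLE V ⊤ hz) ≫ hV.fromSpec := by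
    intro z hz
    have h1 := Scheme.Opens.toSpecΓ_SpecMap_appLE z V ⊤ hz
    have h2 : (⊤ : W.Opens).toSpecΓ ≫ Spec.map (z.appLE V ⊤ hz) ≫ hV.fromSpec =
        (⊤ : W.Opens).ι ≫ z := by
      rw [← Category.assoc, h1, Category.assoc, ← hV.isoSpec_hom]
      rw [IsAffineOpen.fromSpec, Iso.hom_inv_id_assoc, Scheme.Hom.resLE_comp_ι]
    rw [Scheme.Opens.toSpecΓ_top, Category.assoc] at h2
    have : IsIso (⊤ : W.Opens).ι := inferInstanceAs (IsIso W.topIso.hom)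
    exact ((cancel_epi _).mp h2).symm
  rw [key x hx, key y hy, h]

/-- The morphism into an affine open subset with given effect on functions. -/
def homOfRingHom (hV : IsAffineOpen V) (φ : Γ(X, V) ⟶ Γ(W, ⊤)) : W ⟶ X :=
  W.toSpecΓ ≫ Spec.map φ ≫ hV.fromSpec

lemma top_le_fromSpec_preimage (hV : IsAffineOpen V) : ⊤ ≤ hV.fromSpec ⁻¹ᵁ V :=
  hV.fromSpec_preimage_self.ge

lemma fromSpec_appLE (hV : IsAffineOpen V) :
    hV.fromSpec.appLE V ⊤ (top_le_fromSpec_preimage hV) = (Scheme.ΓSpecIso _).inv := by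
  rw [Scheme.Hom.appLE, hV.fromSpec_app_self, Category.assoc, ← Functor.map_comp]
  exact ((Spec Γ(X, V)).presheaf.map_id _).symm ▸ Category.comp_id _

lemma top_le_homOfRingHom_preimage (hV : IsAffineOpen V) (φ : Γ(X, V) ⟶ Γ(W, ⊤)) :
    ⊤ ≤ homOfRingHom hV φ ⁻¹ᵁ V := by
  rw [homOfRingHom, ← Category.assoc, Scheme.Hom.comp_preimage, hV.fromSpec_preimage_self]
  rfl

lemma homOfRingHom_appLE (hV : IsAffineOpen V) (φ : Γ(X, V) ⟶ Γ(W, ⊤)) (h) :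
    (homOfRingHom hV φ).appLE V ⊤ h = φ := by
  unfold homOfRingHom at h ⊢
  rw [← Category.assoc] at h
  simp only [← Category.assoc]
  rw [← Scheme.Hom.appLE_comp_appLE _ _ _ ⊤ _ (top_le_fromSpec_preimage hV)
    (top_le_preimage_top _), fromSpec_appLE]
  rw [appLE_top, Scheme.Hom.comp_appTop, ← Scheme.ΓSpecIso_inv_naturality_assoc,
    Scheme.toSpecΓ_appTop]
  simp

lemma comp_homOfRingHom (hV : IsAffineOpen V) (φ : Γ(X, V) ⟶ Γ(W, ⊤)) (f : W' ⟶ W) :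
    f ≫ homOfRingHom hV φ = homOfRingHom hV (φ ≫ f.appTop) := by
  refine hom_ext_of_isAffineOpen hV (le_top.trans ?_) (top_le_homOfRingHom_preimage _ _) ?_
  · rw [Scheme.Hom.comp_preimage]
    exact f.preimage_mono (top_le_homOfRingHom_preimage hV φ)
  · rw [homOfRingHom_appLE, ← Scheme.Hom.appLE_comp_appLE _ _ _ ⊤ _
      (top_le_homOfRingHom_preimage hV φ) (top_le_preimage_top _), homOfRingHom_appLE, appLE_top]

lemma eq_homOfRingHom (hV : IsAffineOpen V) (x : W ⟶ X) (hx : ⊤ ≤ x ⁻¹ᵁ V) :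
    x = homOfRingHom hV (x.appLE V ⊤ hx) :=
  hom_ext_of_isAffineOpen hV hx (top_le_homOfRingHom_preimage _ _) (homOfRingHom_appLE _ _ _).symm

end AffineTargets

/-! ### Torus actions on affine open subsets -/

section Coaction

lemma map_charEval {ι : Type} [Fintype ι] {G H : Type*} [CommGroup G] [CommGroup H] (f : G →* H)
    (m : ι → ℤ) (t : ι → G) : f (charEval m t) = charEval m (fun i => f (t i)) := by
  simp [charEval]

lemma charEval_zero {ι : Type} [Fintype ι] {G : Type*} [CommGroup G] (t : ι → G) :
    charEval 0 t = 1 := by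
  simp [charEval]

lemma charEval_add {ι : Type} [Fintype ι] {G : Type*} [CommGroup G] (m m' : ι → ℤ) (t : ι → G) :
    charEval (m + m') t = charEval m t * charEval m' t := by
  simp [charEval, zpow_add, Finset.prod_mul_distrib]

/-- Evaluation of characters at a point of a torus. -/
def charHom {ι : Type} [Fintype ι] {G : Type*} [CommGroup G] (t : ι → G) :
    Multiplicative (ι → ℤ) →* G where
  toFun m := charEval m.toAdd t
  map_one' := charEval_zero t
  map_mul' _ _ := charEval_add _ _ t

lemma charEval_zsmul {ι : Type} [Fintype ι] {G : Type*} [CommGroup G] (r : ℤ) (m : ι → ℤ)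
    (t : ι → G) : charEval (r • m) t = charEval m t ^ r :=
  map_zpow (charHom t) (Multiplicative.ofAdd m) r

/-- The ring homomorphism `C[ℤⁿ] → D` given by a ring homomorphism `C → D` and a `D`-point of
the torus. -/
def laurentEval {n : ℕ} {C D : Type*} [CommRing C] [CommRing D] (φ : C →+* D) (t : Fin n → Dˣ) :
    AddMonoidAlgebra C (Fin n → ℤ) →+* D :=
  AddMonoidAlgebra.liftNCRingHom φ ((Units.coeHom D).comp (charHom t)) (fun _ _ => Commute.all _ _)

@[simp]
lemma laurentEval_single {n : ℕ} {C D : Type*} [CommRing C] [CommRing D] (φ : C →+* D)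
    (t : Fin n → Dˣ) (χ : Fin n → ℤ) (c : C) :
    laurentEval φ t (AddMonoidAlgebra.single χ c) = φ c * (charEval χ t : Dˣ) := by
  simp [laurentEval, charHom]

/-- The universal point of the torus. -/
def laurentPoint (n : ℕ) (C : Type*) [CommRing C] :
    Fin n → (AddMonoidAlgebra C (Fin n → ℤ))ˣ := fun i =>
  Units.map (AddMonoidAlgebra.of C (Fin n → ℤ))
    (toUnits (Multiplicative.ofAdd (Pi.single i (1 : ℤ))))

lemma charEval_laurentPoint {n : ℕ} {C : Type*} [CommRing C] (χ : Fin n → ℤ) :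
    ((charEval χ (laurentPoint n C) : (AddMonoidAlgebra C (Fin n → ℤ))ˣ) :
      AddMonoidAlgebra C (Fin n → ℤ)) = AddMonoidAlgebra.single χ 1 := by
  have h := map_charEval ((Units.map (AddMonoidAlgebra.of C (Fin n → ℤ))).comp
    (toUnits (G := Multiplicative (Fin n → ℤ))).toMonoidHom) χ
    (fun i => Multiplicative.ofAdd (Pi.single i (1 : ℤ)))
  have h2 : charEval χ (fun i => Multiplicative.ofAdd (Pi.single i (1 : ℤ) : Fin n → ℤ)) =
      Multiplicative.ofAdd χ := by
    unfold charEval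
    apply Multiplicative.toAdd.injective
    rw [toAdd_prod]
    simp only [toAdd_zpow, toAdd_ofAdd]
    ext j
    simp [Finset.sum_apply, Pi.single_apply]
  rw [h2] at h
  exact (congrArg Units.val h).symm

/-- This is the universality of `laurentPoint`: each point of the torus over a `C`-algebra is a
specialization of it. -/
lemma charEval_map_laurentPoint {n : ℕ} {C D : Type*} [CommRing C] [CommRing D] (φ : C →+* D)
    (t : Fin n → Dˣ) (i : Fin n) :
    Units.map (laurentEval φ t : AddMonoidAlgebra C (Fin n → ℤ) →* D) (laurentPoint n C i) =
      t i := by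
  ext
  simp only [laurentPoint, Units.coe_map, MonoidHom.coe_coe, val_toUnits_apply,
    AddMonoidAlgebra.of_apply, toAdd_ofAdd, laurentEval_single, map_one, one_mul]
  congr 1
  rw [charEval, Finset.prod_eq_single i] <;> simp +contextual


namespace TorusAction

variable {n : ℕ} {X : Scheme.{u}} (a : TorusAction n X) {V : X.Opens}

/-- Stability of an open subset under a torus action. -/
def IsStable (V : X.Opens) : Prop :=
  ∀ {W : Scheme.{u}} (t : TorusPoints (Fin n) W) (x : W ⟶ X), ⊤ ≤ x ⁻¹ᵁ V → ⊤ ≤ a.act t x ⁻¹ᵁ V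

lemma isStable_top : a.IsStable ⊤ := fun _ _ _ => top_le_preimage_top _

lemma isStable_preimage {S : Scheme.{u}} {p : X ⟶ S}
    (hp : ∀ {W : Scheme.{u}} (t : TorusPoints (Fin n) W) (x : W ⟶ X), a.act t x ≫ p = x ≫ p)
    (U : S.Opens) : a.IsStable (p ⁻¹ᵁ U) := by
  intro W t x hx
  rw [← Scheme.Hom.comp_preimage] at hx ⊢
  rwa [hp]

variable {a} (hV : IsAffineOpen V) (hs : a.IsStable V)

/-- Points of a torus with values in a ring, as points with values in its spectrum. -/
def specPoint {ι : Type} (C : CommRingCat.{u}) (t : ι → Cˣ) : TorusPoints ι (Spec C) := fun i =>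
  Units.map ((Scheme.ΓSpecIso C).inv.hom : C →* Γ(Spec C, ⊤)) (t i)

lemma pull_specPoint {ι : Type} {C : CommRingCat.{u}} {W : Scheme.{u}} (f : W ⟶ Spec C)
    (φ : C ⟶ Γ(W, ⊤)) (h : (Scheme.ΓSpecIso C).inv ≫ f.appTop = φ) (t : ι → Cˣ) :
    TorusPoints.pull f (specPoint C t) = fun i => Units.map (φ.hom : C →* Γ(W, ⊤)) (t i) := by
  subst h
  rfl

/-- The coaction on the functions on a torus-stable affine open subset. -/
def coaction : Γ(X, V) →+* AddMonoidAlgebra Γ(X, V) (Fin n → ℤ) :=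
  let C : CommRingCat.{u} := .of (AddMonoidAlgebra Γ(X, V) (Fin n → ℤ))
  let φ : Γ(X, V) ⟶ Γ(Spec C, ⊤) :=
    CommRingCat.ofHom (AddMonoidAlgebra.singleZeroRingHom : Γ(X, V) →+* C) ≫
      (Scheme.ΓSpecIso C).inv
  -- The universal point of the torus acts on the tautological point of `V` over the Laurent ring.
  ((a.act (specPoint C (laurentPoint n Γ(X, V))) (homOfRingHom hV φ)).appLE V ⊤
    (hs _ _ (top_le_homOfRingHom_preimage hV φ)) ≫ (Scheme.ΓSpecIso C).hom).hom

/-- By Yoneda, any pair `(t, x)` with `x` landing in `V` is pulled back from the universal pair over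
the spectrum of the Laurent ring, and `comp_act` transports the action along this pullback. -/
lemma act_appLE {W : Scheme.{u}} (t : TorusPoints (Fin n) W) (x : W ⟶ X) (hx : ⊤ ≤ x ⁻¹ᵁ V)
    (h : ⊤ ≤ a.act t x ⁻¹ᵁ V) :
    ((a.act t x).appLE V ⊤ h).hom =
      (laurentEval (x.appLE V ⊤ hx).hom t).comp (coaction hV hs) := by
  let C : CommRingCat.{u} := .of (AddMonoidAlgebra Γ(X, V) (Fin n → ℤ))
  let φ : Γ(X, V) ⟶ Γ(Spec C, ⊤) :=
    CommRingCat.ofHom (AddMonoidAlgebra.singleZeroRingHom : Γ(X, V) →+* C) ≫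
      (Scheme.ΓSpecIso C).inv
  let ψ : C ⟶ Γ(W, ⊤) := CommRingCat.ofHom (laurentEval (x.appLE V ⊤ hx).hom t)
  let f : W ⟶ Spec C := W.toSpecΓ ≫ Spec.map ψ
  have hf : (Scheme.ΓSpecIso C).inv ≫ f.appTop = ψ := by
    rw [Scheme.Hom.comp_appTop, ← Scheme.ΓSpecIso_inv_naturality_assoc, Scheme.toSpecΓ_appTop]
    simp
  have hx' : f ≫ homOfRingHom hV φ = x := by
    rw [comp_homOfRingHom, eq_homOfRingHom hV x hx]
    congr 1
    rw [Category.assoc, hf]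
    ext r
    simp [ψ, charEval_zero]
  have ht : TorusPoints.pull f (specPoint C (laurentPoint n Γ(X, V))) = t := by
    rw [pull_specPoint f ψ hf]
    funext i
    exact charEval_map_laurentPoint _ _ i
  have key := a.comp_act f (specPoint C (laurentPoint n Γ(X, V))) (homOfRingHom hV φ)
  rw [hx', ht] at key
  have h3 := hs (specPoint C (laurentPoint n Γ(X, V))) _ (top_le_homOfRingHom_preimage hV φ)
  ext r
  simp only [← key]
  rw [appLE_comp_apply f _ h3 (top_le_preimage_top _) (key ▸ h), appLE_top]
  have hψ : ∀ y : Γ(Spec C, ⊤), ψ ((Scheme.ΓSpecIso C).hom y) = f.appTop y := by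
    intro y
    rw [← hf]
    simp
  exact (hψ _).symm

lemma comp_laurentEval {C D E : Type*} [CommRing C] [CommRing D] [CommRing E] (φ : C →+* D)
    (t : Fin n → Dˣ) (ψ : D →+* E) :
    ψ.comp (laurentEval φ t) = laurentEval (ψ.comp φ) (fun i => Units.map (ψ : D →* E) (t i)) := by
  ext x
  · simp [charEval_zero]
  · simp [← map_charEval]

lemma ΓSpecIso_hom_comp_inv {R C : Type u} [CommRing R] [CommRing C] (φ : R →+* C) :
    (Scheme.ΓSpecIso (.of C)).hom.hom.comp
      (CommRingCat.ofHom φ ≫ (Scheme.ΓSpecIso (.of C)).inv).hom = φ := by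
  refine RingHom.ext fun r => ?_
  change ((Scheme.ΓSpecIso (.of C)).inv ≫ (Scheme.ΓSpecIso (.of C)).hom) (φ r) = φ r
  rw [Iso.inv_hom_id]
  rfl

lemma map_specPoint {C : Type u} [CommRing C] {ι : Type} (t : ι → Cˣ) :
    (fun i => Units.map ((Scheme.ΓSpecIso (.of C)).hom.hom : Γ(Spec (.of C), ⊤) →* C)
      (specPoint (.of C) t i)) = t := by
  ext i
  simp [specPoint]

/-- The counit law of the coaction, which is `one_act` on points with values in `C`. -/
lemma laurentEval_one_comp_coaction {C : Type u} [CommRing C] (φ : Γ(X, V) →+* C) :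
    (laurentEval φ 1).comp (coaction hV hs) = φ := by
  let ι := (Scheme.ΓSpecIso (.of C)).inv
  let x : Spec (.of C) ⟶ X := homOfRingHom hV (CommRingCat.ofHom φ ≫ ι)
  have hx : ⊤ ≤ x ⁻¹ᵁ V := top_le_homOfRingHom_preimage hV _
  have h := act_appLE hV hs 1 x hx (hs _ _ hx)
  simp only [a.one_act] at h
  rw [homOfRingHom_appLE] at h
  have h2 := congrArg (RingHom.comp (Scheme.ΓSpecIso (.of C)).hom.hom) h
  rw [← RingHom.comp_assoc, comp_laurentEval] at h2
  rw [ΓSpecIso_hom_comp_inv] at h2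
  convert h2.symm using 3
  ext; simp

/-- Coassociativity, which is `mul_act` on points with values in `C`. -/
lemma laurentEval_mul_comp_coaction {C : Type u} [CommRing C] (φ : Γ(X, V) →+* C)
    (t t' : Fin n → Cˣ) :
    (laurentEval φ (t * t')).comp (coaction hV hs) =
      (laurentEval ((laurentEval φ t').comp (coaction hV hs)) t).comp (coaction hV hs) := by
  let ι := (Scheme.ΓSpecIso (.of C)).inv
  let x : Spec (.of C) ⟶ X := homOfRingHom hV (CommRingCat.ofHom φ ≫ ι)
  have hx : ⊤ ≤ x ⁻¹ᵁ V := top_le_homOfRingHom_preimage hV _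
  have hp : specPoint (.of C) (t * t') = specPoint (.of C) t * specPoint (.of C) t' := by
    ext; simp [specPoint]
  have h := act_appLE hV hs (specPoint (.of C) (t * t')) x hx (hs _ _ hx)
  have h1 := act_appLE hV hs (specPoint (.of C) t') x hx (hs _ _ hx)
  have h2 := act_appLE hV hs (specPoint (.of C) t) _ (hs (specPoint (.of C) t') x hx)
    (hs _ _ (hs _ _ hx))
  simp only [hp, a.mul_act] at h
  rw [h2, h1, homOfRingHom_appLE] at h
  have h3 := congrArg (RingHom.comp (Scheme.ΓSpecIso (.of C)).hom.hom) h
  simp only [← RingHom.comp_assoc, comp_laurentEval] at h3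
  rw [ΓSpecIso_hom_comp_inv, map_specPoint, map_specPoint, ← hp, map_specPoint] at h3
  exact h3.symm

lemma coaction_of_mem {χ : Fin n → ℤ} {f : Γ(X, V)} (hf : f ∈ a.weightSpace V χ) :
    coaction hV hs f = AddMonoidAlgebra.single χ f := by
  let C : CommRingCat.{u} := .of (AddMonoidAlgebra Γ(X, V) (Fin n → ℤ))
  let φ : Γ(X, V) ⟶ Γ(Spec C, ⊤) :=
    CommRingCat.ofHom (AddMonoidAlgebra.singleZeroRingHom : Γ(X, V) →+* C) ≫
      (Scheme.ΓSpecIso C).inv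
  have hx : ⊤ ≤ homOfRingHom hV φ ⁻¹ᵁ V := top_le_homOfRingHom_preimage hV φ
  have h := hf _ (specPoint C (laurentPoint n Γ(X, V))) (homOfRingHom hV φ) hx (hs _ _ hx)
  have h2 := congrArg (Scheme.ΓSpecIso C).hom.hom h
  refine h2.trans ?_
  rw [map_mul, homOfRingHom_appLE]
  have h3 : (Scheme.ΓSpecIso C).hom.hom (φ f) = AddMonoidAlgebra.single 0 f :=
    congrArg (fun ψ : Γ(X, V) →+* C => ψ f) (ΓSpecIso_hom_comp_inv
      (AddMonoidAlgebra.singleZeroRingHom : Γ(X, V) →+* C))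
  have h4 : (Scheme.ΓSpecIso C).hom.hom
      (charEval χ (specPoint C (laurentPoint n Γ(X, V))) : Γ(Spec C, ⊤)ˣ) =
        AddMonoidAlgebra.single χ 1 := by
    rw [← charEval_laurentPoint]
    have := map_charEval (Units.map ((Scheme.ΓSpecIso C).hom.hom : Γ(Spec C, ⊤) →* C)) χ
      (specPoint C (laurentPoint n Γ(X, V)))
    rw [map_specPoint] at this
    exact congrArg Units.val this
  refine (congrArg₂ (· * ·) h4 h3).trans
    ((AddMonoidAlgebra.single_mul_single (R := Γ(X, V)) χ 0 1 f).trans ?_)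
  rw [add_zero, one_mul]

lemma coeff_laurentEval_laurentPoint {C R : Type*} [CommRing C] [CommRing R] (φ : R →+* C)
    (y : AddMonoidAlgebra R (Fin n → ℤ)) (χ : Fin n → ℤ) :
    (laurentEval (AddMonoidAlgebra.singleZeroRingHom.comp φ) (laurentPoint n C) y).coeff χ =
      φ (y.coeff χ) := by
  induction y using AddMonoidAlgebra.induction_linear with
  | zero => simp
  | add x y hx hy => simp [hx, hy]
  | single m r =>
    rw [laurentEval_single, charEval_laurentPoint]
    by_cases h : m = χ <;> simp [AddMonoidAlgebra.single_mul_single, h]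

lemma coeff_laurentEval_mul_laurentPoint {R : Type*} [CommRing R]
    (y : AddMonoidAlgebra R (Fin n → ℤ)) (χ : Fin n → ℤ) :
    (laurentEval ((AddMonoidAlgebra.singleZeroRingHom
        (R := AddMonoidAlgebra R (Fin n → ℤ))).comp AddMonoidAlgebra.singleZeroRingHom)
      (laurentPoint n (AddMonoidAlgebra R (Fin n → ℤ)) * fun r =>
        Units.map (AddMonoidAlgebra.singleZeroRingHom
          (R := AddMonoidAlgebra R (Fin n → ℤ)) (M := Fin n → ℤ) : _ →* _)
            (laurentPoint n R r)) y).coeff χ = AddMonoidAlgebra.single χ (y.coeff χ) := by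
  induction y using AddMonoidAlgebra.induction_linear with
  | zero => simp
  | add x y hx hy => simp only [map_add, AddMonoidAlgebra.coeff_add, Finsupp.add_apply, hx, hy,
      AddMonoidAlgebra.single_add]
  | single m r =>
    rw [laurentEval_single, charEval_mul, ← map_charEval, Units.val_mul, charEval_laurentPoint,
      Units.coe_map, charEval_laurentPoint]
    by_cases h : m = χ <;> simp [AddMonoidAlgebra.single_mul_single, h]

/-- Coassociativity is applied to two independent universal points, over the Laurent ring of a
Laurent ring. Comparing the coefficients of `χ` in the outer variables gives the formula. -/
lemma coaction_coaction (f : Γ(X, V)) (χ : Fin n → ℤ) :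
    coaction hV hs ((coaction hV hs f).coeff χ) =
      AddMonoidAlgebra.single χ ((coaction hV hs f).coeff χ) := by
  have h := laurentEval_mul_comp_coaction hV hs ((AddMonoidAlgebra.singleZeroRingHom
      (R := AddMonoidAlgebra Γ(X, V) (Fin n → ℤ)) (M := Fin n → ℤ)).comp
        (AddMonoidAlgebra.singleZeroRingHom (M := Fin n → ℤ)))
    (laurentPoint n (AddMonoidAlgebra Γ(X, V) (Fin n → ℤ)))
    (fun r => Units.map (AddMonoidAlgebra.singleZeroRingHom
          (R := AddMonoidAlgebra Γ(X, V) (Fin n → ℤ)) (M := Fin n → ℤ) : _ →* _)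
            (laurentPoint n Γ(X, V) r))
  rw [← comp_laurentEval, RingHom.comp_assoc] at h
  have h1 : laurentEval AddMonoidAlgebra.singleZeroRingHom (laurentPoint n Γ(X, V)) =
      RingHom.id _ := by
    refine AddMonoidAlgebra.ringHom_ext (fun r => ?_) fun m => ?_
    · rw [laurentEval_single, charEval_zero]
      simp
    · rw [laurentEval_single, charEval_laurentPoint]
      simp
  rw [h1, RingHom.id_comp] at h
  have h2 := congrArg (fun φ : Γ(X, V) →+* AddMonoidAlgebra _ _ => (φ f).coeff χ) h
  simp only [RingHom.comp_apply, coeff_laurentEval_mul_laurentPoint,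
    coeff_laurentEval_laurentPoint] at h2
  exact h2.symm

lemma mem_weightSpace_of_coaction {χ : Fin n → ℤ} {f : Γ(X, V)}
    (hf : coaction hV hs f = AddMonoidAlgebra.single χ f) : f ∈ a.weightSpace V χ := by
  intro W t x hx htx
  have h := congrArg (fun φ : Γ(X, V) →+* Γ(W, ⊤) => φ f) (act_appLE hV hs t x hx htx)
  simp only [RingHom.comp_apply, hf, laurentEval_single] at h
  rw [mul_comm]
  exact h

lemma coaction_coeff_mem (f : Γ(X, V)) (χ : Fin n → ℤ) :
    (coaction hV hs f).coeff χ ∈ a.weightSpace V χ :=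
  mem_weightSpace_of_coaction hV hs (coaction_coaction hV hs f χ)

/-- Setting the torus variables to `1` recovers `f`. With `coaction_coeff_mem` this is the weight
decomposition of the functions on a stable affine open set. -/
lemma sum_coaction_coeff (f : Γ(X, V)) :
    ((coaction hV hs f).coeff.sum fun _ r => r) = f := by
  have h := congrArg (fun φ : Γ(X, V) →+* Γ(X, V) => φ f)
    (laurentEval_one_comp_coaction hV hs (RingHom.id _))
  simp only [RingHom.comp_apply, RingHom.id_apply] at h
  have h2 : ∀ y : AddMonoidAlgebra Γ(X, V) (Fin n → ℤ),
      (y.coeff.sum fun _ r => r) = laurentEval (RingHom.id _) 1 y := by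
    intro y
    induction y using AddMonoidAlgebra.induction_linear with
    | zero => simp
    | add x y hx hy =>
      rw [map_add, ← hx, ← hy, AddMonoidAlgebra.coeff_add, Finsupp.sum_add_index'] <;> simp
    | single m r => simp [charEval_one]
  rw [h2, h]

end TorusAction

end Coaction

/-! ### Weight spaces -/

namespace TorusAction

variable {n : ℕ} {X : Scheme.{u}} (a : TorusAction n X) {V : X.Opens}

lemma one_mem_weightSpace : (1 : Γ(X, V)) ∈ a.weightSpace V 0 := by
  intro W t x hx htx
  simp [charEval_zero]

lemma mul_mem_weightSpace {χ χ' : Fin n → ℤ} {f g : Γ(X, V)} (hf : f ∈ a.weightSpace V χ)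
    (hg : g ∈ a.weightSpace V χ') : f * g ∈ a.weightSpace V (χ + χ') := by
  intro W t x hx htx
  rw [map_mul, map_mul, hf W t x hx htx, hg W t x hx htx, charEval_add, Units.val_mul]
  ring

lemma pow_mem_weightSpace {χ : Fin n → ℤ} {f : Γ(X, V)} (hf : f ∈ a.weightSpace V χ) (r : ℕ) :
    f ^ r ∈ a.weightSpace V (r • χ) := by
  induction r with
  | zero => simpa using a.one_mem_weightSpace
  | succ r ih => rw [pow_succ, succ_nsmul]; exact a.mul_mem_weightSpace ih hf

lemma appLE_mem_weightSpace {Y : Scheme.{u}} {b : TorusAction n Y} (h : Y ⟶ X)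
    (hh : ∀ {W : Scheme.{u}} (t : TorusPoints (Fin n) W) (y : W ⟶ Y),
      b.act t y ≫ h = a.act t (y ≫ h))
    {V' : Y.Opens} (hV : V' ≤ h ⁻¹ᵁ V) {χ : Fin n → ℤ} {f : Γ(X, V)}
    (hf : f ∈ a.weightSpace V χ) : h.appLE V V' hV f ∈ b.weightSpace V' χ := by
  intro W t y hy hty
  have h1 : ⊤ ≤ (y ≫ h) ⁻¹ᵁ V := by
    rw [Scheme.Hom.comp_preimage]; exact hy.trans (y.preimage_mono hV)
  have h2 : ⊤ ≤ (b.act t y ≫ h) ⁻¹ᵁ V := by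
    rw [Scheme.Hom.comp_preimage]; exact hty.trans ((b.act t y).preimage_mono hV)
  rw [← appLE_comp_apply y h hV hy h1, ← appLE_comp_apply (b.act t y) h hV hty h2]
  simp only [hh]
  exact hf W t (y ≫ h) h1 (hh t y ▸ h2)

lemma map_mem_weightSpace {V' : X.Opens} (hV : V' ≤ V) {χ : Fin n → ℤ} {f : Γ(X, V)}
    (hf : f ∈ a.weightSpace V χ) :
    X.presheaf.map (homOfLE hV).op f ∈ a.weightSpace V' χ := by
  have := a.appLE_mem_weightSpace (b := a) (𝟙 X) (by simp) (V' := V') (V := V) hV hf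
  rwa [show (𝟙 X : X ⟶ X).appLE V V' hV = X.presheaf.map (homOfLE hV).op from
    Category.id_comp _] at this

lemma app_mem_weightSpace {S : Scheme.{u}} {p : X ⟶ S}
    (hp : ∀ {W : Scheme.{u}} (t : TorusPoints (Fin n) W) (x : W ⟶ X), a.act t x ≫ p = x ≫ p)
    {U : S.Opens} (hV : V ≤ p ⁻¹ᵁ U) (c : Γ(S, U)) : p.appLE U V hV c ∈ a.weightSpace V 0 := by
  intro W t x hx htx
  have h1 : ⊤ ≤ (x ≫ p) ⁻¹ᵁ U := by
    rw [Scheme.Hom.comp_preimage]; exact hx.trans (x.preimage_mono hV)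
  have h2 : ⊤ ≤ (a.act t x ≫ p) ⁻¹ᵁ U := by rw [hp]; exact h1
  rw [← appLE_comp_apply x p hV hx h1, ← appLE_comp_apply (a.act t x) p hV htx h2]
  simp [hp, charEval_zero]

lemma coaction_coeff_self {V : X.Opens} (hV : IsAffineOpen V) (hs : a.IsStable V)
    {χ : Fin n → ℤ} {f : Γ(X, V)} (hf : f ∈ a.weightSpace V χ) :
    (coaction hV hs f).coeff χ = f := by
  rw [coaction_of_mem hV hs hf]; simp

lemma coaction_coeff_of_ne {V : X.Opens} (hV : IsAffineOpen V) (hs : a.IsStable V)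
    {χ χ' : Fin n → ℤ} {f : Γ(X, V)} (hf : f ∈ a.weightSpace V χ) (h : χ ≠ χ') :
    (coaction hV hs f).coeff χ' = 0 := by
  rw [coaction_of_mem hV hs hf]; simp [h]

end TorusAction

/-! ### Base change of rings -/

/-- Here `P` is `K ⊗_B R`, so a `B`-linear form on `R` extends to a `K`-linear form on `P`. In
`restr_ne_zero` such a form detects that a section is non-zero on a fibre. -/
lemma exists_isPushout_linearExtension {B R K P : CommRingCat.{u}} {f : B ⟶ R} {g : B ⟶ K}
    {i : R ⟶ P} {j : K ⟶ P} (h : IsPushout f g i j) (l : R →+ B)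
    (hl : ∀ b r, l (f b * r) = b * l r) :
    ∃ L : P →+ K, ∀ c r, L (j c * i r) = c * g (l r) := by
  algebraize [f.hom, g.hom, i.hom, j.hom, (f ≫ i).hom]
  have : IsScalarTower B R P := .of_algebraMap_eq' rfl
  have : IsScalarTower B K P := .of_algebraMap_eq' (congrArg CommRingCat.Hom.hom h.w)
  have H : Algebra.IsPushout B R K P := CommRingCat.isPushout_iff_isPushout.mp h
  have H' := H.symm.out
  let l' : R →ₗ[B] K :=
    { toFun := fun r => g (l r)
      map_add' := by simp
      map_smul' := fun b r => by
        simp only [Algebra.smul_def, RingHom.id_apply]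
        exact (congrArg g (hl b r)).trans (map_mul _ _ _) }
  refine ⟨(H'.lift l').toAddMonoidHom, fun c r => ?_⟩
  have h1 : j c * i r = c • (IsScalarTower.toAlgHom B R P).toLinearMap r := by
    rw [Algebra.smul_def]; rfl
  rw [h1]
  change H'.lift l' _ = _
  rw [map_smul, H'.lift_eq]
  rfl

lemma isPushout_induction {B R K P : CommRingCat.{u}} {f : B ⟶ R} {g : B ⟶ K}
    {i : R ⟶ P} {j : K ⟶ P} (h : IsPushout f g i j) {Q : P → Prop} (h0 : Q 0)
    (hadd : ∀ x y, Q x → Q y → Q (x + y)) (hmul : ∀ c r, Q (j c * i r)) (x : P) : Q x := by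
  algebraize [f.hom, g.hom, i.hom, j.hom, (f ≫ i).hom]
  have : IsScalarTower B R P := .of_algebraMap_eq' rfl
  have : IsScalarTower B K P := .of_algebraMap_eq' (congrArg CommRingCat.Hom.hom h.w)
  have H : Algebra.IsPushout B R K P := CommRingCat.isPushout_iff_isPushout.mp h
  have H' := H.symm.out
  obtain ⟨z, rfl⟩ := H'.equiv.surjective x
  induction z using TensorProduct.induction_on with
  | zero => rwa [map_zero]
  | add x y hx hy => rw [map_add]; exact hadd _ _ hx hy
  | tmul c r => rw [H'.equiv_tmul, Algebra.smul_def]; exact hmul c r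

/-- Restriction of functions to a smaller open set. -/
def resFun {S : Scheme.{u}} {U V : S.Opens} (h : V ≤ U) : Γ(S, U) →+* Γ(S, V) :=
  (S.presheaf.map (homOfLE h).op).hom

lemma resFun_resFun {S : Scheme.{u}} {U V V' : S.Opens} (h : V ≤ U) (h' : V' ≤ V) (c : Γ(S, U)) :
    resFun h' (resFun h c) = resFun (h'.trans h) c := by
  change (S.presheaf.map _ ≫ S.presheaf.map _) c = S.presheaf.map _ c
  rw [← Functor.map_comp]
  rfl

lemma eq_of_locally_eq {S : Scheme.{u}} {U : S.Opens} {c c' : Γ(S, U)}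
    (h : ∀ s ∈ U, ∃ (V : S.Opens) (hV : V ≤ U), s ∈ V ∧ resFun hV c = resFun hV c') : c = c' := by
  choose V hV hs h using h
  refine S.sheaf.eq_of_locally_eq' (fun s : U => V s.1 s.2) _
    (fun s => homOfLE (hV s.1 s.2)) ?_ c c' fun s => h s.1 s.2
  intro x hx
  rw [TopologicalSpace.Opens.mem_iSup]
  exact ⟨⟨x, hx⟩, hs _ _⟩

lemma exists_glue {S : Scheme.{u}} {ι : Type u} (V : ι → S.Opens)
    (hV : ∀ s : S, ∃ i, s ∈ V i) (c : ∀ i, Γ(S, V i))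
    (hc : ∀ i j, resFun (inf_le_left : V i ⊓ V j ≤ V i) (c i) =
      resFun (inf_le_right : V i ⊓ V j ≤ V j) (c j)) :
    ∃ d : Γ(S, ⊤), ∀ i, resFun le_top d = c i := by
  obtain ⟨d, hd, -⟩ := S.sheaf.existsUnique_gluing' V ⊤ (fun i => homOfLE le_top)
    (fun s _ => TopologicalSpace.Opens.mem_iSup.mpr (hV s)) c hc
  exact ⟨d, hd⟩

/-! ### Sections of the weight sheaves of a family -/

namespace StableToricFamily

variable {k : Type u} [Field k] {n : ℕ} {𝕏 : IrredAffineTVariety k n} {S : Scheme.{u}}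
  {strS : S ⟶ Spec (.of k)} (X : StableToricFamily 𝕏 strS)

lemma isAffineOpen_preimage {U : S.Opens} (hU : IsAffineOpen U) : IsAffineOpen (X.pS ⁻¹ᵁ U) :=
  have := X.isFamily.isAffineHom
  hU.preimage X.pS

lemma isStable_preimage (U : S.Opens) : X.action.IsStable (X.pS ⁻¹ᵁ U) :=
  X.action.isStable_preimage X.isFamily.invariant U

/-- Restriction of functions from the preimage of `U` to that of a smaller open set. -/
def res {U V : S.Opens} (h : V ≤ U) : Γ(X.X, X.pS ⁻¹ᵁ U) →+* Γ(X.X, X.pS ⁻¹ᵁ V) :=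
  (X.X.presheaf.map (homOfLE (X.pS.preimage_mono h)).op).hom

lemma res_mem {U V : S.Opens} (h : V ≤ U) {χ : Fin n → ℤ} {f : Γ(X.X, X.pS ⁻¹ᵁ U)}
    (hf : f ∈ X.sections U χ) : X.res h f ∈ X.sections V χ :=
  X.action.map_mem_weightSpace _ hf

lemma res_app {U V : S.Opens} (h : V ≤ U) (c : Γ(S, U)) :
    X.res h (X.pS.app U c) = X.pS.app V (resFun h c) := by
  change (X.pS.app U ≫ X.X.presheaf.map _) c = (S.presheaf.map _ ≫ X.pS.app V) c
  rw [Scheme.Hom.naturality]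
  rfl

lemma res_res {U V V' : S.Opens} (h : V ≤ U) (h' : V' ≤ V) (f : Γ(X.X, X.pS ⁻¹ᵁ U)) :
    X.res h' (X.res h f) = X.res (h'.trans h) f := by
  change (X.X.presheaf.map _ ≫ X.X.presheaf.map _) f = X.X.presheaf.map _ f
  rw [← Functor.map_comp]
  rfl

lemma smul_mem {U : S.Opens} {χ : Fin n → ℤ} {f : Γ(X.X, X.pS ⁻¹ᵁ U)}
    (hf : f ∈ X.sections U χ) (c : Γ(S, U)) : X.pS.app U c * f ∈ X.sections U χ := by
  have := X.action.mul_mem_weightSpace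
    (X.action.app_mem_weightSpace X.isFamily.invariant le_rfl c) hf
  rwa [Scheme.Hom.appLE_eq_app, zero_add] at this

lemma eq_of_locally_eq {U : S.Opens} {f g : Γ(X.X, X.pS ⁻¹ᵁ U)}
    (h : ∀ s ∈ U, ∃ (V : S.Opens) (hV : V ≤ U), s ∈ V ∧ X.res hV f = X.res hV g) : f = g := by
  choose V hV hs h using h
  refine X.X.sheaf.eq_of_locally_eq' (fun s : U => X.pS ⁻¹ᵁ (V s.1 s.2)) _
    (fun s => homOfLE (X.pS.preimage_mono (hV s.1 s.2))) ?_ f g fun s => h s.1 s.2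
  intro x hx
  rw [TopologicalSpace.Opens.mem_iSup]
  exact ⟨⟨X.pS x, hx⟩, hs _ _⟩

/-- A section of weight `χ` that generates the subsheaf of weight `χ` freely. -/
def IsGenerator (U : S.Opens) (χ : Fin n → ℤ) (e : Γ(X.X, X.pS ⁻¹ᵁ U)) : Prop :=
  e ∈ X.sections U χ ∧ ∀ (V : S.Opens) (hV : V ≤ U), ∀ f ∈ X.sections V χ,
    ∃! c : Γ(S, V), f = X.pS.app V c * X.res hV e

variable {X}

lemma IsGenerator.res {U V : S.Opens} {χ : Fin n → ℤ} {e : Γ(X.X, X.pS ⁻¹ᵁ U)}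
    (he : X.IsGenerator U χ e) (h : V ≤ U) : X.IsGenerator V χ (X.res h e) := by
  refine ⟨X.res_mem h he.1, fun V' hV' f hf => ?_⟩
  simp only [res_res]
  exact he.2 V' (hV'.trans h) f hf

lemma IsGenerator.existsUnique {U : S.Opens} {χ : Fin n → ℤ} {e f : Γ(X.X, X.pS ⁻¹ᵁ U)}
    (he : X.IsGenerator U χ e) (hf : f ∈ X.sections U χ) : ∃! c, f = X.pS.app U c * e := by
  have := he.2 U le_rfl f hf
  have h : X.res le_rfl e = e := by
    change X.X.presheaf.map (𝟙 _) e = e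
    rw [CategoryTheory.Functor.map_id]; rfl
  rwa [h] at this

lemma IsGenerator.app_mul_injective {U : S.Opens} {χ : Fin n → ℤ} {e : Γ(X.X, X.pS ⁻¹ᵁ U)}
    (he : X.IsGenerator U χ e) {c c' : Γ(S, U)} (h : X.pS.app U c * e = X.pS.app U c' * e) :
    c = c' :=
  (he.existsUnique (X.smul_mem he.1 c)).unique rfl h

variable (X)

lemma exists_isGenerator {χ : Fin n → ℤ} (hχ : χ ∈ 𝕏.saturation) {U : S.Opens} {s : S}
    (hs : s ∈ U) : ∃ (V : S.Opens) (_ : V ≤ U), IsAffineOpen V ∧ s ∈ V ∧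
      ∃ e, X.IsGenerator V χ e := by
  have h := X.isFamily.locallyFree χ
  rw [hilbertFunction, if_pos hχ] at h
  obtain ⟨U', hs', e, he, h⟩ := h s
  obtain ⟨_, ⟨V, hV, rfl⟩, hsV, hVU⟩ :=
    S.isBasis_affineOpens.exists_subset_of_mem_open (show s ∈ ↑(U ⊓ U') from ⟨hs, hs'⟩)
      (U ⊓ U').isOpen
  have hVU1 : V ≤ U := fun x hx => (hVU hx).1
  have hVU2 : V ≤ U' := fun x hx => (hVU hx).2
  have hg : X.IsGenerator U' χ (e 0) := by
    refine ⟨he 0, fun V hV f hf => ?_⟩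
    obtain ⟨c, hc, hu⟩ := h V hV f hf
    refine ⟨c 0, hc.trans (Fin.sum_univ_one _), fun c' hc' => ?_⟩
    exact congrFun (hu (fun _ => c') (by beta_reduce; rw [Fin.sum_univ_one]; exact hc')) 0
  exact ⟨V, hVU1, hV, hsV, _, hg.res hVU2⟩

lemma eq_zero_of_notMem {χ : Fin n → ℤ} (hχ : χ ∉ 𝕏.saturation) {U : S.Opens}
    {f : Γ(X.X, X.pS ⁻¹ᵁ U)} (hf : f ∈ X.sections U χ) : f = 0 := by
  have h := X.isFamily.locallyFree χ
  rw [hilbertFunction, if_neg hχ] at h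
  refine X.eq_of_locally_eq fun s hs => ?_
  obtain ⟨U', hs', e, he, h⟩ := h s
  refine ⟨U ⊓ U', inf_le_left, ⟨hs, hs'⟩, ?_⟩
  obtain ⟨c, hc, -⟩ := h (U ⊓ U') inf_le_right _ (X.res_mem inf_le_left hf)
  rw [hc]; simp

end StableToricFamily

/-! ### Geometric fibres -/

section Fibres

variable {k : Type u} [Field k] {n : ℕ} {𝕏 : IrredAffineTVariety k n} {S : Scheme.{u}}
  {strS : S ⟶ Spec (.of k)}

/-- A geometric fibre of a family, as a scheme with a torus action that satisfies the universal
property of the fibre product. -/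
structure GeometricFibre (X : StableToricFamily 𝕏 strS) where
  K : Type u
  [field : Field K]
  [isAlgClosed : IsAlgClosed K]
  s : Spec (.of K) ⟶ S
  Y : Scheme.{u}
  action : TorusAction n Y
  ι : Y ⟶ X.X
  p : Y ⟶ Spec (.of K)
  isPullback : IsPullback ι p X.pS s
  equivariant : ∀ {W : Scheme.{u}} (t : TorusPoints (Fin n) W) (y : W ⟶ Y),
    action.act t y ≫ ι = X.action.act t (y ≫ ι)
  invariant : ∀ {W : Scheme.{u}} (t : TorusPoints (Fin n) W) (y : W ⟶ Y),
    action.act t y ≫ p = y ≫ p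

namespace GeometricFibre

attribute [instance] GeometricFibre.field GeometricFibre.isAlgClosed

/-- The fibre product with a geometric point. -/
def ofPoint (X : StableToricFamily 𝕏 strS) (K : Type u) [Field K] [IsAlgClosed K]
    (s : Spec (.of K) ⟶ S) : GeometricFibre X where
  K := K
  s := s
  Y := pullback X.pS s
  action := X.action.baseChange X.pS X.isFamily.invariant s
  ι := pullback.fst _ _
  p := pullback.snd _ _
  isPullback := IsPullback.of_hasPullback _ _
  equivariant _ _ := pullback.lift_fst _ _ _
  invariant _ _ := pullback.lift_snd _ _ _

/-- The fibre of a family over an algebraically closed field. -/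
def self [IsAlgClosed k] (Y : StableToricFamily 𝕏 (𝟙 (Spec (.of k)))) : GeometricFibre Y where
  K := k
  s := 𝟙 _
  Y := Y.X
  action := Y.action
  ι := 𝟙 _
  p := Y.pS
  isPullback := IsPullback.of_horiz_isIso ⟨by simp⟩
  equivariant t y := by simp
  invariant := Y.isFamily.invariant

variable {X : StableToricFamily 𝕏 strS} (F : GeometricFibre X)

instance : IsAffine F.Y :=
  have := X.isFamily.isAffineHom
  .of_isPullback F.isPullback.flip

instance : AlgebraicGeometry.IsReduced F.Y :=
  have := X.reduced F.K F.s
  isReduced_of_isOpenImmersion F.isPullback.isoPullback.hom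

/-- The point of the base under a geometric fibre. -/
def point : S := F.s (IsLocalRing.closedPoint F.K)

lemma top_le_preimage {U : S.Opens} (h : F.point ∈ U) : ⊤ ≤ F.s ⁻¹ᵁ U := by
  intro x _
  have : x = IsLocalRing.closedPoint F.K := Subsingleton.elim (α := PrimeSpectrum F.K) _ _
  rw [this]
  exact h

lemma top_le_ι_preimage {U : S.Opens} (h : F.point ∈ U) : ⊤ ≤ F.ι ⁻¹ᵁ (X.pS ⁻¹ᵁ U) := by
  rw [← Scheme.Hom.comp_preimage, F.isPullback.w, Scheme.Hom.comp_preimage]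
  exact F.p.preimage_mono (F.top_le_preimage h)

/-- The scalars, as functions on a geometric fibre. -/
def scalar : F.K →+* Γ(F.Y, ⊤) := ((Scheme.ΓSpecIso (.of F.K)).inv ≫ F.p.appTop).hom

/-- The value of a function on the base. -/
def value {U : S.Opens} (h : F.point ∈ U) : Γ(S, U) →+* F.K :=
  (F.s.appLE U ⊤ (F.top_le_preimage h) ≫ (Scheme.ΓSpecIso (.of F.K)).hom).hom

/-- Restriction of functions to a geometric fibre. -/
def restr {U : S.Opens} (h : F.point ∈ U) : Γ(X.X, X.pS ⁻¹ᵁ U) →+* Γ(F.Y, ⊤) :=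
  (F.ι.appLE (X.pS ⁻¹ᵁ U) ⊤ (F.top_le_ι_preimage h)).hom

lemma restr_app {U : S.Opens} (h : F.point ∈ U) (c : Γ(S, U)) :
    F.restr h (X.pS.app U c) = F.scalar (F.value h c) := by
  have h1 : X.pS.app U ≫ F.ι.appLE (X.pS ⁻¹ᵁ U) ⊤ (F.top_le_ι_preimage h) =
      F.s.appLE U ⊤ (F.top_le_preimage h) ≫ F.p.appTop := by
    rw [← Scheme.Hom.appLE_eq_app, ← appLE_top _ (top_le_preimage_top F.p),
      Scheme.Hom.appLE_comp_appLE, Scheme.Hom.appLE_comp_appLE]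
    simp only [F.isPullback.w]
  change (X.pS.app U ≫ F.ι.appLE (X.pS ⁻¹ᵁ U) ⊤ (F.top_le_ι_preimage h)) c =
    (F.s.appLE U ⊤ (F.top_le_preimage h) ≫ ((Scheme.ΓSpecIso (.of F.K)).hom ≫
      (Scheme.ΓSpecIso (.of F.K)).inv) ≫ F.p.appTop) c
  rw [Iso.hom_inv_id, Category.id_comp, h1]

lemma restr_res {U V : S.Opens} (hV : V ≤ U) (h : F.point ∈ V) (f : Γ(X.X, X.pS ⁻¹ᵁ U)) :
    F.restr h (X.res hV f) = F.restr (hV h) f := by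
  change (X.X.presheaf.map _ ≫ F.ι.appLE _ _ _) f = _
  rw [Scheme.Hom.map_appLE]
  rfl

lemma value_map {U V : S.Opens} (hV : V ≤ U) (h : F.point ∈ V) (c : Γ(S, U)) :
    F.value h (resFun hV c) = F.value (hV h) c := by
  change (S.presheaf.map _ ≫ F.s.appLE _ _ _ ≫ _) c = _
  rw [Scheme.Hom.map_appLE_assoc]
  rfl

lemma value_eq_zero_iff {U : S.Opens} (h : F.point ∈ U) (c : Γ(S, U)) :
    F.value h c = 0 ↔ F.point ∉ S.basicOpen c := by
  have h1 : F.value h c = 0 ↔ F.s.appLE U ⊤ (F.top_le_preimage h) c = 0 :=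
    map_eq_zero_iff (Scheme.ΓSpecIso (.of F.K)).hom.hom
      (Scheme.ΓSpecIso (.of F.K)).commRingCatIsoToRingEquiv.injective
  rw [h1, ← basicOpen_eq_bot_iff, Scheme.basicOpen_appLE, top_inf_eq, eq_bot_iff]
  refine ⟨fun h2 h3 => h2 (show IsLocalRing.closedPoint F.K ∈ F.s ⁻¹ᵁ _ from h3),
    fun h2 x hx => h2 ?_⟩
  have : x = IsLocalRing.closedPoint F.K := Subsingleton.elim (α := PrimeSpectrum F.K) _ _
  rw [this] at hx
  exact hx

lemma restr_mem {U : S.Opens} (h : F.point ∈ U) {χ : Fin n → ℤ} {f : Γ(X.X, X.pS ⁻¹ᵁ U)}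
    (hf : f ∈ X.sections U χ) : F.restr h f ∈ F.action.weightSpace ⊤ χ :=
  X.action.appLE_mem_weightSpace F.ι F.equivariant _ hf

lemma scalar_mem (c : F.K) : F.scalar c ∈ F.action.weightSpace ⊤ 0 := by
  have := F.action.app_mem_weightSpace F.invariant (top_le_preimage_top F.p)
    ((Scheme.ΓSpecIso (.of F.K)).inv c)
  rwa [appLE_top] at this

/-- The functions on the fibre are the functions over an affine `U` tensored with `K`, because all
the schemes in the fibre square over `U` are affine. -/
lemma isPushout {U : S.Opens} (hU : IsAffineOpen U) (h : F.point ∈ U) :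
    IsPushout (X.pS.app U) (F.s.appLE U ⊤ (F.top_le_preimage h))
      (F.ι.appLE (X.pS ⁻¹ᵁ U) ⊤ (F.top_le_ι_preimage h)) F.p.appTop := by
  have h1 := isIso_pushoutSection_of_isAffineOpen F.isPullback (F.top_le_preimage h) le_rfl
    (UY := ⊤) (by simpa [eq_comm] using F.top_le_ι_preimage h) hU (isAffineOpen_top _)
    (X.isAffineOpen_preimage hU)
  have h2 := (isIso_pushoutSection_iff ..).mp h1
  rw [Scheme.Hom.appLE_eq_app, appLE_top] at h2
  exact h2

lemma restr_induction {U : S.Opens} (hU : IsAffineOpen U) (h : F.point ∈ U)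
    {Q : Γ(F.Y, ⊤) → Prop} (h0 : Q 0) (hadd : ∀ x y, Q x → Q y → Q (x + y))
    (hmul : ∀ (c : F.K) (χ : Fin n → ℤ), ∀ f ∈ X.sections U χ, Q (F.scalar c * F.restr h f))
    (x : Γ(F.Y, ⊤)) : Q x := by
  refine isPushout_induction (F.isPushout hU h) h0 hadd (fun c r => ?_) x
  have hc : F.p.appTop c = F.scalar ((Scheme.ΓSpecIso (.of F.K)).hom c) := by
    change _ = (((Scheme.ΓSpecIso (.of F.K)).hom ≫ (Scheme.ΓSpecIso (.of F.K)).inv) ≫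
      F.p.appTop) c
    rw [Iso.hom_inv_id, Category.id_comp]
  have hr := TorusAction.sum_coaction_coeff (X.isAffineOpen_preimage hU) (X.isStable_preimage U) r
  change Q (_ * F.restr h r)
  rw [hc, ← hr, Finsupp.sum, map_sum, Finset.mul_sum]
  refine Finset.sum_induction _ Q hadd h0 fun χ _ => hmul _ χ _ ?_
  exact TorusAction.coaction_coeff_mem _ _ _ _

lemma isStable : F.action.IsStable ⊤ := F.action.isStable_top

/-- The coaction on the functions on a geometric fibre. -/
abbrev coact : Γ(F.Y, ⊤) →+* AddMonoidAlgebra Γ(F.Y, ⊤) (Fin n → ℤ) :=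
  TorusAction.coaction (isAffineOpen_top F.Y) F.isStable

lemma mul_restr_mem {U : S.Opens} (h : F.point ∈ U) {χ : Fin n → ℤ} {f : Γ(X.X, X.pS ⁻¹ᵁ U)}
    (hf : f ∈ X.sections U χ) (c : F.K) :
    F.scalar c * F.restr h f ∈ F.action.weightSpace ⊤ χ := by
  have := F.action.mul_mem_weightSpace (F.scalar_mem c) (F.restr_mem h hf)
  rwa [zero_add] at this

lemma mem_closure_of_mem_weightSpace {U : S.Opens} (hU : IsAffineOpen U) (h : F.point ∈ U)
    {χ : Fin n → ℤ} {y : Γ(F.Y, ⊤)} (hy : y ∈ F.action.weightSpace ⊤ χ) :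
    y ∈ AddSubgroup.closure {z | ∃ c, ∃ f ∈ X.sections U χ, z = F.scalar c * F.restr h f} := by
  rw [← F.action.coaction_coeff_self (isAffineOpen_top F.Y) F.isStable hy]
  -- Being of weight `χ` is lost when `y` is split into summands, so the induction concerns the
  -- component of weight `χ` of an arbitrary function.
  clear hy
  induction y using F.restr_induction hU h with
  | h0 => simp
  | hadd x y hx hy =>
    rw [map_add, AddMonoidAlgebra.coeff_add, Finsupp.add_apply]
    exact add_mem hx hy
  | hmul c χ' f hf =>
    by_cases hχ : χ' = χ
    · subst hχ
      rw [TorusAction.coaction_coeff_self _ _ _ (F.mul_restr_mem h hf c)]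
      exact AddSubgroup.subset_closure ⟨c, f, hf, rfl⟩
    · rw [TorusAction.coaction_coeff_of_ne _ _ _ (F.mul_restr_mem h hf c) hχ]
      exact zero_mem _

lemma eq_zero_of_notMem {χ : Fin n → ℤ} (hχ : χ ∉ 𝕏.saturation) {y : Γ(F.Y, ⊤)}
    (hy : y ∈ F.action.weightSpace ⊤ χ) : y = 0 := by
  obtain ⟨_, ⟨U, hU, rfl⟩, hs, -⟩ :=
    S.isBasis_affineOpens.exists_subset_of_mem_open (Set.mem_univ F.point) isOpen_univ
  have h := F.mem_closure_of_mem_weightSpace hU hs hy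
  rw [← AddSubgroup.mem_bot]
  refine (AddSubgroup.closure_le _).mpr ?_ h
  rintro _ ⟨c, f, hf, rfl⟩
  simp [X.eq_zero_of_notMem hχ hf]

lemma exists_eq_scalar_mul {U : S.Opens} (hU : IsAffineOpen U) (h : F.point ∈ U)
    {χ : Fin n → ℤ} {e : Γ(X.X, X.pS ⁻¹ᵁ U)} (he : X.IsGenerator U χ e) {y : Γ(F.Y, ⊤)}
    (hy : y ∈ F.action.weightSpace ⊤ χ) : ∃ c, y = F.scalar c * F.restr h e := by
  have h := F.mem_closure_of_mem_weightSpace hU h hy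
  clear hy
  induction h using AddSubgroup.closure_induction with
  | mem z hz =>
    obtain ⟨c, f, hf, rfl⟩ := hz
    obtain ⟨b, rfl, -⟩ := he.existsUnique hf
    exact ⟨c * F.value _ b, by rw [map_mul, map_mul, restr_app, mul_assoc]⟩
  | zero => exact ⟨0, by simp⟩
  | add x y _ _ hx hy =>
    obtain ⟨c, rfl⟩ := hx
    obtain ⟨d, rfl⟩ := hy
    exact ⟨c + d, by rw [map_add, add_mul]⟩
  | neg x _ hx =>
    obtain ⟨c, rfl⟩ := hx
    exact ⟨-c, by simp⟩

/-- Projection to weight `χ`, followed by the coordinate with respect to `e`, is a linear form over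
`Γ(S, U)` that takes the value `1` at `e`. Its base change to `K` takes the value `1` at the
restriction of `e`. -/
lemma restr_ne_zero {U : S.Opens} (hU : IsAffineOpen U) (h : F.point ∈ U)
    {χ : Fin n → ℤ} {e : Γ(X.X, X.pS ⁻¹ᵁ U)} (he : X.IsGenerator U χ e) :
    F.restr h e ≠ 0 := by
  have hx : ∀ r : Γ(X.X, X.pS ⁻¹ᵁ U), ∃! c, (TorusAction.coaction (X.isAffineOpen_preimage hU)
      (X.isStable_preimage U) r).coeff χ = X.pS.app U c * e := fun r =>
    he.existsUnique (TorusAction.coaction_coeff_mem _ _ _ _)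
  choose l hl hl' using hx
  let l' : Γ(X.X, X.pS ⁻¹ᵁ U) →+ Γ(S, U) :=
    { toFun := l
      map_zero' := (hl' 0 0 (by simp)).symm
      map_add' := fun r r' => (hl' (r + r') _ (by
        simp only [map_add, AddMonoidAlgebra.coeff_add, Finsupp.add_apply, add_mul, hl])).symm }
  obtain ⟨L, hL⟩ := exists_isPushout_linearExtension (F.isPushout hU h) l' (fun b r => by
    refine (hl' _ _ ?_).symm
    have hb := X.action.app_mem_weightSpace X.isFamily.invariant (le_refl (X.pS ⁻¹ᵁ U)) b
    rw [Scheme.Hom.appLE_eq_app] at hb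
    change _ = X.pS.app U (b * l r) * e
    rw [map_mul, TorusAction.coaction_of_mem _ _ hb, map_mul, mul_assoc, ← hl]
    simp)
  intro h0
  have h1 := hL 1 e
  have h2 : l' e = 1 := (hl' e _ (by
    beta_reduce
    rw [TorusAction.coaction_coeff_self _ _ _ he.1, map_one, one_mul])).symm
  change L (_ * F.restr h e) = _ at h1
  rw [h0, h2, mul_zero, map_zero, map_one, mul_one] at h1
  have h3 := congrArg (Scheme.ΓSpecIso (.of F.K)).hom.hom h1
  rw [map_zero, map_one] at h3
  exact zero_ne_one (α := F.K) h3

end GeometricFibre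

end Fibres

/-! ### Characters and monoids of weights -/

section Lattice

/-- A homomorphism on a monoid can be evaluated on integral combinations of its elements as long as
the total lies in the monoid: the negative part of `m` is moved to the other side, where all
exponents are natural numbers. -/
lemma prod_zpow_eq_of_isMonoidHomOn {ι M G : Type*} [Fintype ι] [AddCommGroup M] [CommGroup G]
    (P : AddSubmonoid M) (Ψ : M → G) (h0 : Ψ 0 = 1)
    (hadd : ∀ x ∈ P, ∀ y ∈ P, Ψ (x + y) = Ψ x * Ψ y) (v : ι → M) (m : ι → ℤ)
    (hm : ∀ i, v i ∉ P → m i = 0) (hP : ∑ i, m i • v i ∈ P) :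
    ∏ i, Ψ (v i) ^ m i = Ψ (∑ i, m i • v i) := by
  have key : ∀ (a : ι → ℕ), (∀ i, v i ∉ P → a i = 0) →
      ∑ i, a i • v i ∈ P ∧ Ψ (∑ i, a i • v i) = ∏ i, Ψ (v i) ^ a i := by
    intro a ha
    have h1 : ∀ i, a i • v i ∈ P ∧ Ψ (a i • v i) = Ψ (v i) ^ a i := by
      intro i
      by_cases hi : v i ∈ P
      · generalize a i = r
        induction r with
        | zero => simp [h0]
        | succ r ih =>
          rw [succ_nsmul, pow_succ, hadd _ ih.1 _ hi, ih.2]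
          exact ⟨add_mem ih.1 hi, rfl⟩
      · simp [ha i hi, h0]
    generalize (Finset.univ : Finset ι) = s
    classical
    induction s using Finset.induction_on with
    | empty => simp [h0]
    | insert i s hi ih =>
      rw [Finset.sum_insert hi, Finset.prod_insert hi, hadd _ (h1 i).1 _ ih.1, ih.2, (h1 i).2]
      exact ⟨add_mem (h1 i).1 ih.1, rfl⟩
  obtain ⟨-, hp⟩ := key (fun i => (m i).toNat) fun i hi => by simp [hm i hi]
  obtain ⟨hn, hn'⟩ := key (fun i => (-m i).toNat) fun i hi => by simp [hm i hi]
  have h2 : ∑ i, (m i).toNat • v i = ∑ i, m i • v i + ∑ i, (-m i).toNat • v i := by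
    rw [← Finset.sum_add_distrib]
    refine Finset.sum_congr rfl fun i _ => ?_
    rw [← natCast_zsmul, ← natCast_zsmul, ← add_smul]
    congr 1
    omega
  rw [h2, hadd _ hP _ hn, hn'] at hp
  rw [← mul_inv_eq_iff_eq_mul.mpr hp.symm, ← Finset.prod_inv_distrib, ← Finset.prod_mul_distrib]
  refine Finset.prod_congr rfl fun i _ => ?_
  rw [← zpow_natCast, ← zpow_natCast, ← zpow_neg, ← zpow_add]
  congr 1
  omega

variable {k : Type u} [Field k] {n : ℕ}

/-- Characters that are trivial on the kernel of a homomorphism of lattices factor through it,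
after extension to the target. -/
lemma exists_charEval_latticeMap {K : Type u} [Field K] [IsAlgClosed K]
    (A : Finset (Fin n → ℤ)) (P : AddSubgroup (A → ℤ)) (t : A → Kˣ)
    (ht : ∀ m ∈ P, latticeMap A m = 0 → charEval m t = 1) :
    ∃ τ : Fin n → Kˣ, ∀ m ∈ P, charEval m t = charEval (latticeMap A m) τ := by
  let f : P →ₗ[ℤ] (Fin n → ℤ) := ((latticeMap A).comp P.subtype).toIntLinearMap
  let g : P →ₗ[ℤ] Additive Kˣ :=
    ((MonoidHom.toAdditiveRight (charHom t)).comp P.subtype).toIntLinearMap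
  have hg : LinearMap.ker f ≤ LinearMap.ker g := by
    intro m hm
    exact congrArg Additive.ofMul (ht m.1 m.2 hm)
  -- `K^×` is divisible because `K` is algebraically closed, hence an injective `ℤ`-module. The
  -- character induced on the image of `P` under `α` therefore extends to all of `ℤⁿ`, and the
  -- values on the basis are the coordinates of `τ`.
  have hdiv : ∀ {r : ℤ}, r ≠ 0 → Function.Surjective fun x : Additive Kˣ => r • x := by
    intro r hr x
    obtain ⟨z, hz⟩ := IsAlgClosed.exists_pow_nat_eq (x.toMul : K) (Int.natAbs_pos.mpr hr)
    have hz0 : z ≠ 0 := by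
      rintro rfl
      rw [zero_pow (Int.natAbs_ne_zero.mpr hr)] at hz
      exact x.toMul.ne_zero hz.symm
    have hz' : Units.mk0 z hz0 ^ r.natAbs = x.toMul := Units.ext (by simpa using hz)
    rcases Int.natAbs_eq r with h | h
    · refine ⟨Additive.ofMul (Units.mk0 z hz0), ?_⟩
      beta_reduce
      rw [h, natCast_zsmul, ← ofMul_pow, hz', ofMul_toMul]
    · refine ⟨-Additive.ofMul (Units.mk0 z hz0), ?_⟩
      beta_reduce
      rw [h, neg_smul, smul_neg, neg_neg, natCast_zsmul, ← ofMul_pow, hz', ofMul_toMul]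
  let _ : DivisibleBy (Additive Kˣ) ℤ := divisibleByOfSMulRightSurj _ _ hdiv
  obtain ⟨h, hh⟩ := (Module.Baer.of_divisible (Additive Kˣ)).extension_property
    ((LinearMap.ker f).liftQ f le_rfl)
    (LinearMap.ker_eq_bot.mp (Submodule.ker_liftQ_eq_bot _ _ _ le_rfl))
    ((LinearMap.ker f).liftQ g hg)
  refine ⟨fun i => (h (Pi.single i 1)).toMul, fun m hm => ?_⟩
  have h1 := congrArg (fun φ => φ (Submodule.Quotient.mk ⟨m, hm⟩)) hh
  have h2 : ∀ χ : Fin n → ℤ, h χ =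
      Additive.ofMul (charEval χ fun i => (h (Pi.single i 1)).toMul) := by
    intro χ
    conv_lhs => rw [← Finset.univ_sum_single χ]
    rw [map_sum, charEval, ofMul_prod]
    refine Finset.sum_congr rfl fun i _ => ?_
    rw [ofMul_zpow, ofMul_toMul, ← map_zsmul, ← Pi.single_smul]
    simp
  exact Additive.ofMul.injective (h1.symm.trans (h2 _))

end Lattice

/-! ### Weights on irreducible components -/

section Components

variable {n : ℕ} {Y : Scheme.{u}} (b : TorusAction n Y)

/-- The homomorphism is evaluation at the generic point of `Z`: the non-vanishing locus of `f` is
open, so it contains that point as soon as it meets `Z`. Values in a field make products of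
functions easy to control. -/
lemma exists_evaluation {Z : Set Y} (hZ : Z ∈ irreducibleComponents Y) :
    ∃ (L : Type u) (_ : Field L) (ε : Γ(Y, ⊤) →+* L),
      ∀ f, ε f ≠ 0 ↔ ∃ z ∈ Z, z ∈ Y.basicOpen f := by
  have h1 : IsIrreducible Z := hZ.1
  have h2 : IsClosed Z := isClosed_of_mem_irreducibleComponents Z hZ
  have h3 := h1.isGenericPoint_genericPoint h2
  refine ⟨Y.residueField h1.genericPoint, inferInstance, (Y.Γevaluation h1.genericPoint).hom,
    fun f => (Y.evaluation_ne_zero_iff_mem_basicOpen (U := ⊤) _ trivial f).trans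
      ⟨fun h => ⟨_, h3.mem, h⟩, ?_⟩⟩
  rintro ⟨z, hz, hzf⟩
  exact (h3.specializes hz).mem_open (Y.basicOpen f).isOpen hzf

lemma eq_zero_of_evaluation [AlgebraicGeometry.IsReduced Y] {f : Γ(Y, ⊤)}
    (h : ∀ Z ∈ irreducibleComponents Y, ∀ z ∈ Z, z ∉ Y.basicOpen f) : f = 0 := by
  rw [← basicOpen_eq_bot_iff, eq_bot_iff]
  intro z hz
  exact (h _ (irreducibleComponent_mem_irreducibleComponents z) z mem_irreducibleComponent hz).elim

namespace TorusAction

/-- The weights of a component form a monoid. -/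
def weightSubmonoid {Z : Set Y} (hZ : Z ∈ irreducibleComponents Y) :
    AddSubmonoid (Fin n → ℤ) where
  carrier := b.weightSet Z
  zero_mem' := by
    obtain ⟨z, hz⟩ := hZ.1.1
    exact ⟨1, b.one_mem_weightSpace, z, hz, by simp⟩
  add_mem' := by
    rintro χ χ' ⟨f, hf, hz⟩ ⟨f', hf', hz'⟩
    obtain ⟨L, _, ε, hε⟩ := exists_evaluation hZ
    refine ⟨f * f', b.mul_mem_weightSpace hf hf', (hε _).mp ?_⟩
    rw [map_mul]
    exact mul_ne_zero ((hε _).mpr hz) ((hε _).mpr hz')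

lemma exists_mem_weightSet [AlgebraicGeometry.IsReduced Y] {χ : Fin n → ℤ} {f : Γ(Y, ⊤)}
    (hf : f ∈ b.weightSpace ⊤ χ) (h0 : f ≠ 0) :
    ∃ Z ∈ irreducibleComponents Y, χ ∈ b.weightSet Z := by
  by_contra! h
  exact h0 (eq_zero_of_evaluation fun Z hZ z hz hzf => h Z hZ ⟨f, hf, z, hz, hzf⟩)

/-- If functions on an affine scheme are generated by functions of weight zero and functions
whose weight belongs to `A`, then the weights of a component are generated as a group by those
in `A`. -/
lemma exists_latticeMap_eq [IsAffine Y] {A : Finset (Fin n → ℤ)}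
    (hgen : Subring.closure {f | f ∈ b.weightSpace ⊤ 0 ∨ ∃ χ ∈ A, f ∈ b.weightSpace ⊤ χ} = ⊤)
    {Z : Set Y} (hZ : Z ∈ irreducibleComponents Y) {χ : Fin n → ℤ} (hχ : χ ∈ b.weightSet Z) :
    ∃ m ∈ subLattice A (b.weightSet Z), latticeMap A m = χ := by
  classical
  obtain ⟨L, _, ε, hε⟩ := exists_evaluation hZ
  -- The grading is coarsened modulo the group `M'` generated by `A ∩ Σ_Z`, and functions are
  -- evaluated at the generic point of `Z`. A generator either vanishes on `Z` or has weight in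
  -- `M'`, so the resulting coaction is trivial. A function of weight `χ` that does not vanish on
  -- `Z` then forces `χ ∈ M'`.
  let M' := (subLattice A (b.weightSet Z)).map (latticeMap A)
  let q : Multiplicative (Fin n → ℤ) →* Multiplicative ((Fin n → ℤ) ⧸ M') :=
    AddMonoidHom.toMultiplicative (QuotientAddGroup.mk' M')
  let ρ : AddMonoidAlgebra Γ(Y, ⊤) (Fin n → ℤ) →+* AddMonoidAlgebra L ((Fin n → ℤ) ⧸ M') :=
    AddMonoidAlgebra.liftNCRingHom (AddMonoidAlgebra.singleZeroRingHom.comp ε)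
      ((AddMonoidAlgebra.of L _).comp q) (fun _ _ => Commute.all _ _)
  have hρ : ∀ χ f, ρ (AddMonoidAlgebra.single χ f) =
      AddMonoidAlgebra.single (QuotientAddGroup.mk' M' χ) (ε f) := by
    intro χ f
    simp [ρ, q, AddMonoidAlgebra.single_mul_single]
  have hc : ∀ χ, ∀ f ∈ b.weightSpace ⊤ χ, coaction (isAffineOpen_top Y) b.isStable_top f =
      AddMonoidAlgebra.single χ f := fun χ f hf => coaction_of_mem _ _ hf
  have heq : ρ.comp (coaction (isAffineOpen_top Y) b.isStable_top) =
      AddMonoidAlgebra.singleZeroRingHom.comp ε := by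
    refine RingHom.eq_of_eqOn_set_dense hgen ?_
    rintro f (hf | ⟨χ, hχ, hf⟩)
    · rw [RingHom.comp_apply, hc _ f hf, hρ]
      simp
    · rw [RingHom.comp_apply, hc _ f hf, hρ]
      by_cases h0 : ε f = 0
      · simp [h0]
      · have hZ : χ ∈ b.weightSet Z := ⟨f, hf, (hε f).mp h0⟩
        have : QuotientAddGroup.mk' M' χ = 0 := by
          rw [QuotientAddGroup.mk'_apply, QuotientAddGroup.eq_zero_iff]
          refine ⟨Pi.single ⟨χ, hχ⟩ 1, ?_, ?_⟩
          · intro χ' hχ'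
            rw [Pi.single_apply, if_neg]
            rintro rfl
            exact hχ' hZ
          · simp [latticeMap, Pi.single_apply]
        rw [this]
        simp
  obtain ⟨f, hf, hz⟩ := hχ
  have h1 := congrArg (fun φ : Γ(Y, ⊤) →+* _ => φ f) heq
  simp only [RingHom.comp_apply, hc _ f hf, hρ] at h1
  change AddMonoidAlgebra.single _ _ = AddMonoidAlgebra.single _ _ at h1
  rw [AddMonoidAlgebra.single_left_inj ((hε f).mpr hz), QuotientAddGroup.mk'_apply,
    QuotientAddGroup.eq_zero_iff] at h1
  exact h1

end TorusAction

end Components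

/-! ### Weights and generators on geometric fibres -/

namespace GeometricFibre

variable {k : Type u} [Field k] {n : ℕ} {𝕏 : IrredAffineTVariety k n} {S : Scheme.{u}}
  {strS : S ⟶ Spec (.of k)} {X : StableToricFamily 𝕏 strS} (F : GeometricFibre X)

lemma exists_ne_zero {χ : Fin n → ℤ} (hχ : χ ∈ 𝕏.saturation) :
    ∃ e ∈ F.action.weightSpace ⊤ χ, e ≠ 0 := by
  obtain ⟨U, -, hU, hs, e, he⟩ := X.exists_isGenerator hχ (U := ⊤) (s := F.point) trivial
  exact ⟨_, F.restr_mem hs he.1, F.restr_ne_zero hU hs he⟩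

lemma weightSet_subset (Z : Set F.Y) : F.action.weightSet Z ⊆ 𝕏.saturation := by
  rintro χ ⟨f, hf, z, hz, hzf⟩
  by_contra h
  rw [F.eq_zero_of_notMem h hf] at hzf
  simp at hzf

lemma exists_mem_weightSet {χ : Fin n → ℤ} (hχ : χ ∈ 𝕏.saturation) :
    ∃ Z ∈ irreducibleComponents F.Y, χ ∈ F.action.weightSet Z := by
  obtain ⟨e, he, h0⟩ := F.exists_ne_zero hχ
  exact F.action.exists_mem_weightSet he h0

lemma scalar_injective : Function.Injective F.scalar := by
  obtain ⟨e, -, h0⟩ := F.exists_ne_zero (χ := 0) ⟨1, one_pos, by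
    have := 𝕏.isIntegral
    rw [smul_zero]
    exact ⟨1, 𝕏.action.one_mem_weightSpace, one_ne_zero⟩⟩
  have : Nontrivial Γ(F.Y, ⊤) := ⟨_, _, h0⟩
  exact F.scalar.injective

lemma scalar_mul_cancel {f : Γ(F.Y, ⊤)} (hf : f ≠ 0) {c d : F.K}
    (h : F.scalar c * f = F.scalar d * f) : c = d := by
  by_contra hne
  refine hf ?_
  have h1 : F.scalar (c - d) * f = 0 := by rw [map_sub, sub_mul, h, sub_self]
  calc f = F.scalar ((c - d)⁻¹ * (c - d)) * f := by
        rw [inv_mul_cancel₀ (sub_ne_zero.mpr hne), map_one, one_mul]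
    _ = 0 := by rw [map_mul, mul_assoc, h1, mul_zero]

/-- Generation by `A` over an affine neighbourhood passes to the fibre, whose ring is generated by
restrictions and scalars. Functions from the base become scalars, which have weight zero. -/
lemma closure_eq_top {A : Finset (Fin n → ℤ)} {N : ℕ} (hAN : IsAdmissible 𝕏 A N) :
    Subring.closure {f | f ∈ F.action.weightSpace ⊤ 0 ∨
      ∃ χ ∈ A, f ∈ F.action.weightSpace ⊤ χ} = ⊤ := by
  obtain ⟨_, ⟨U, hU, rfl⟩, hs, -⟩ :=
    S.isBasis_affineOpens.exists_subset_of_mem_open (Set.mem_univ F.point) isOpen_univ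
  rw [eq_top_iff, ← CommRingCat.closure_range_union_range_eq_top_of_isPushout
    (F.isPushout hU hs), Subring.closure_le]
  rintro _ (⟨r, rfl⟩ | ⟨c, rfl⟩)
  · have hr : r ∈ Subring.closure (Set.range (X.pS.app U) ∪ {f | ∃ χ ∈ A, f ∈ X.sections U χ}) := by
      rw [hAN.generates strS X U hU]; trivial
    have hr' : F.restr hs r ∈ Subring.map (F.restr hs) _ := ⟨r, hr, rfl⟩
    rw [RingHom.map_closure] at hr'
    refine Subring.closure_mono ?_ hr'
    rintro _ ⟨_, ⟨c, rfl⟩ | ⟨χ, hχ, hf⟩, rfl⟩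
    · rw [F.restr_app]
      exact Or.inl (F.scalar_mem _)
    · exact Or.inr ⟨χ, hχ, F.restr_mem hs hf⟩
  · refine Subring.subset_closure (Or.inl ?_)
    have := F.action.app_mem_weightSpace F.invariant (top_le_preimage_top F.p) c
    rwa [appLE_top] at this

lemma exists_latticeMap_eq {A : Finset (Fin n → ℤ)} {N : ℕ} (hAN : IsAdmissible 𝕏 A N)
    {Z : Set F.Y} (hZ : Z ∈ irreducibleComponents F.Y) {χ : Fin n → ℤ}
    (hχ : χ ∈ F.action.weightSet Z) :
    ∃ m ∈ subLattice A (F.action.weightSet Z), latticeMap A m = χ :=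
  F.action.exists_latticeMap_eq (F.closure_eq_top hAN) hZ hχ

end GeometricFibre

/-! ### Endomorphisms of families -/

lemma hom_ext_of_forall_preimage {X S Y : Scheme.{u}} (p : X ⟶ S) {g h : X ⟶ Y}
    (H : ∀ U : S.Opens, IsAffineOpen U → (p ⁻¹ᵁ U).ι ≫ g = (p ⁻¹ᵁ U).ι ≫ h) : g = h := by
  have hc : ⨆ U : S.affineOpens, p ⁻¹ᵁ U.1 = ⊤ := by
    rw [← Scheme.Hom.preimage_iSup, iSup_affineOpens_eq_top]
    rfl
  exact (X.openCoverOfIsOpenCover _ hc).hom_ext _ _ fun U => H U.1 U.2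

namespace StableToricFamily

section Endomorphisms

variable {k : Type u} [Field k] {n : ℕ} {𝕏 : IrredAffineTVariety k n} {S : Scheme.{u}}
  {strS : S ⟶ Spec (.of k)} {X : StableToricFamily 𝕏 strS}

lemma hom_preimage_ge (g : X ⟶ X) (U : S.Opens) :
    X.pS ⁻¹ᵁ U ≤ (Hom.hom g) ⁻¹ᵁ (X.pS ⁻¹ᵁ U) := by
  rw [← Scheme.Hom.comp_preimage, Hom.comp_pS]

/-- The effect of an endomorphism on the functions on the preimage of an open set of the base. -/
def pull (g : X ⟶ X) (U : S.Opens) : Γ(X.X, X.pS ⁻¹ᵁ U) →+* Γ(X.X, X.pS ⁻¹ᵁ U) :=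
  ((Hom.hom g).appLE (X.pS ⁻¹ᵁ U) (X.pS ⁻¹ᵁ U) (hom_preimage_ge g U)).hom

lemma pull_app (g : X ⟶ X) (U : S.Opens) (c : Γ(S, U)) :
    pull g U (X.pS.app U c) = X.pS.app U c := by
  change (X.pS.app U ≫ (Hom.hom g).appLE _ _ _) c = _
  rw [← Scheme.Hom.appLE_eq_app, Scheme.Hom.appLE_comp_appLE]
  simp only [Hom.comp_pS]

variable (X) in
/-- The effect of the morphism to the variety `𝕏` on functions. -/
def pullX (U : S.Opens) : Γ(𝕏.X, ⊤) →+* Γ(X.X, X.pS ⁻¹ᵁ U) :=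
  (X.pX.appLE ⊤ (X.pS ⁻¹ᵁ U) ((show _ ≤ ⊤ from le_top).trans (top_le_preimage_top X.pX))).hom

lemma pull_pullX (g : X ⟶ X) (U : S.Opens) (f : Γ(𝕏.X, ⊤)) :
    pull g U (X.pullX U f) = X.pullX U f := by
  change (X.pX.appLE ⊤ (X.pS ⁻¹ᵁ U) ((show _ ≤ ⊤ from le_top).trans (top_le_preimage_top X.pX)) ≫
    (Hom.hom g).appLE _ _ _) f = _
  rw [Scheme.Hom.appLE_comp_appLE]
  simp only [Hom.comp_pX]
  rfl

lemma pull_mem (g : X ⟶ X) {U : S.Opens} {χ : Fin n → ℤ} {f : Γ(X.X, X.pS ⁻¹ᵁ U)}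
    (hf : f ∈ X.sections U χ) : pull g U f ∈ X.sections U χ :=
  X.action.appLE_mem_weightSpace (Hom.hom g) (Hom.equivariant g) _ hf

lemma res_pull (g : X ⟶ X) {U V : S.Opens} (h : V ≤ U) (f : Γ(X.X, X.pS ⁻¹ᵁ U)) :
    X.res h (pull g U f) = pull g V (X.res h f) := by
  change ((Hom.hom g).appLE _ _ _ ≫ X.X.presheaf.map _) f =
    (X.X.presheaf.map _ ≫ (Hom.hom g).appLE _ _ _) f
  rw [Scheme.Hom.appLE_map, Scheme.Hom.map_appLE]

lemma pull_comp (g h : X ⟶ X) (U : S.Opens) (f : Γ(X.X, X.pS ⁻¹ᵁ U)) :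
    pull (g ≫ h) U f = pull g U (pull h U f) := by
  change (Hom.hom g ≫ Hom.hom h).appLE _ _ _ f = ((Hom.hom h).appLE _ _ _ ≫
    (Hom.hom g).appLE _ _ _) f
  rw [Scheme.Hom.appLE_comp_appLE]

lemma pull_id (U : S.Opens) (f : Γ(X.X, X.pS ⁻¹ᵁ U)) : pull (𝟙 X) U f = f := by
  have h : (𝟙 X.X : X.X ⟶ X.X).appLE (X.pS ⁻¹ᵁ U) (X.pS ⁻¹ᵁ U) (hom_preimage_ge (𝟙 X) U) =
      X.X.presheaf.map (𝟙 _) := Category.id_comp _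
  change (𝟙 X.X : X.X ⟶ X.X).appLE (X.pS ⁻¹ᵁ U) (X.pS ⁻¹ᵁ U) (hom_preimage_ge (𝟙 X) U) f = f
  rw [h, CategoryTheory.Functor.map_id]
  rfl

lemma top_le_ι_comp_hom_preimage (g : X ⟶ X) (U : S.Opens) :
    ⊤ ≤ ((X.pS ⁻¹ᵁ U).ι ≫ Hom.hom g) ⁻¹ᵁ (X.pS ⁻¹ᵁ U) := by
  rw [Scheme.Hom.comp_preimage]
  exact (Scheme.Opens.ι_preimage_self _).ge.trans
    (Scheme.Hom.preimage_mono _ (hom_preimage_ge g U))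

lemma hom_ext_of_pull {g h : X ⟶ X}
    (H : ∀ U : S.Opens, IsAffineOpen U → ∀ f, pull g U f = pull h U f) : g = h := by
  refine Hom.ext ?_
  refine hom_ext_of_forall_preimage X.pS fun U hU => ?_
  refine hom_ext_of_isAffineOpen (X.isAffineOpen_preimage hU) (top_le_ι_comp_hom_preimage g U)
    (top_le_ι_comp_hom_preimage h U) ?_
  have h1 : (Hom.hom g).appLE _ _ (hom_preimage_ge g U) =
      (Hom.hom h).appLE _ _ (hom_preimage_ge h U) := by
    ext f
    exact H U hU f
  rw [← Scheme.Hom.appLE_comp_appLE _ _ _ (X.pS ⁻¹ᵁ U) _ (hom_preimage_ge g U)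
      (Scheme.Opens.ι_preimage_self _).ge,
    ← Scheme.Hom.appLE_comp_appLE _ _ _ (X.pS ⁻¹ᵁ U) _ (hom_preimage_ge h U)
      (Scheme.Opens.ι_preimage_self _).ge, h1]

variable (X) in
lemma eq_of_forall_app_mul {χ : Fin n → ℤ} (hχ : χ ∈ 𝕏.saturation) {U : S.Opens} {c c' : Γ(S, U)}
    (h : ∀ (V : S.Opens) (hV : V ≤ U), ∀ f ∈ X.sections V χ,
      X.pS.app V (resFun hV c) * f = X.pS.app V (resFun hV c') * f) : c = c' := by
  refine StableToric.eq_of_locally_eq fun s hs => ?_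
  obtain ⟨V, hV, -, hsV, e, he⟩ := X.exists_isGenerator hχ hs
  exact ⟨V, hV, hsV, he.app_mul_injective (h V hV e he.1)⟩

/-- Locally `g` sends a generator of `ℱ_χ` to a multiple of itself, and linearity over the base
makes this factor valid for all sections of weight `χ`. It does not depend on the generator, so the
local factors glue. -/
lemma existsUnique_multiplier (g : X ⟶ X) {χ : Fin n → ℤ} (hχ : χ ∈ 𝕏.saturation) :
    ∃! c : Γ(S, ⊤), ∀ (U : S.Opens), ∀ f ∈ X.sections U χ,
      pull g U f = X.pS.app U (resFun le_top c) * f := by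
  have hloc : ∀ s : S, ∃ (V : S.Opens) (_ : s ∈ V) (c : Γ(S, V)), ∀ (W : S.Opens) (hW : W ≤ V),
      ∀ f ∈ X.sections W χ, pull g W f = X.pS.app W (resFun hW c) * f := by
    intro s
    obtain ⟨V, -, -, hsV, e, he⟩ := X.exists_isGenerator hχ (U := ⊤) (s := s) trivial
    obtain ⟨c, hc, -⟩ := he.existsUnique (pull_mem g he.1)
    refine ⟨V, hsV, c, fun W hW f hf => ?_⟩
    obtain ⟨b, rfl, -⟩ := (he.res hW).existsUnique hf
    rw [map_mul, pull_app, ← res_pull, hc, map_mul, res_app]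
    ring
  choose V hs c hc using hloc
  obtain ⟨d, hd⟩ := exists_glue V (fun s => ⟨s, hs s⟩) c (by
      intro s s'
      refine X.eq_of_forall_app_mul hχ fun W hW f hf => ?_
      rw [resFun_resFun, resFun_resFun, ← hc s _ _ f hf, ← hc s' _ _ f hf])
  have key : ∀ (U : S.Opens), ∀ f ∈ X.sections U χ,
      pull g U f = X.pS.app U (resFun le_top d) * f := by
    intro U f hf
    refine X.eq_of_locally_eq fun s hsU => ⟨U ⊓ V s, inf_le_left, ⟨hsU, hs s⟩, ?_⟩
    rw [res_pull, map_mul, res_app, resFun_resFun, hc s _ inf_le_right _ (X.res_mem _ hf), ← hd,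
      resFun_resFun]
  refine ⟨d, key, fun d' hd' => X.eq_of_forall_app_mul hχ fun U _ f hf => ?_⟩
  rw [← key U f hf, ← hd' U f hf]

/-- The function on the base by which an endomorphism multiplies functions of weight `χ`. -/
def multiplier (g : X ⟶ X) {χ : Fin n → ℤ} (hχ : χ ∈ 𝕏.saturation) : Γ(S, ⊤) :=
  (existsUnique_multiplier g hχ).choose

lemma pull_eq_multiplier_mul (g : X ⟶ X) {χ : Fin n → ℤ} (hχ : χ ∈ 𝕏.saturation) {U : S.Opens}
    {f : Γ(X.X, X.pS ⁻¹ᵁ U)} (hf : f ∈ X.sections U χ) :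
    pull g U f = X.pS.app U (resFun le_top (multiplier g hχ)) * f :=
  (existsUnique_multiplier g hχ).choose_spec.1 U f hf

lemma eq_multiplier {g : X ⟶ X} {χ : Fin n → ℤ} (hχ : χ ∈ 𝕏.saturation) {c : Γ(S, ⊤)}
    (h : ∀ (U : S.Opens), ∀ f ∈ X.sections U χ,
      pull g U f = X.pS.app U (resFun le_top c) * f) : multiplier g hχ = c :=
  ((existsUnique_multiplier g hχ).choose_spec.2 c h).symm

lemma multiplier_id {χ : Fin n → ℤ} (hχ : χ ∈ 𝕏.saturation) : multiplier (𝟙 X) hχ = 1 :=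
  eq_multiplier hχ fun U f _ => by rw [pull_id, map_one, map_one, one_mul]

lemma multiplier_comp (g h : X ⟶ X) {χ : Fin n → ℤ} (hχ : χ ∈ 𝕏.saturation) :
    multiplier (g ≫ h) hχ = multiplier h hχ * multiplier g hχ :=
  eq_multiplier hχ fun U f hf => by
    rw [pull_comp, pull_eq_multiplier_mul h hχ hf, map_mul, pull_app,
      pull_eq_multiplier_mul g hχ hf, map_mul, map_mul, mul_assoc]

/-- The homomorphism from automorphisms of a family to points of the big torus. -/
def multiplierHom (X : StableToricFamily 𝕏 strS) {A : Finset (Fin n → ℤ)}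
    (hA : (A : Set (Fin n → ℤ)) ⊆ 𝕏.saturation) : Aut X →* TorusPoints A S where
  toFun g χ :=
    { val := multiplier g.hom (hA χ.2)
      inv := multiplier g.inv (hA χ.2)
      val_inv := by rw [← multiplier_comp, g.inv_hom_id, multiplier_id]
      inv_val := by rw [← multiplier_comp, g.hom_inv_id, multiplier_id] }
  map_one' := funext fun χ => Units.ext (multiplier_id (hA χ.2))
  -- In `Aut`, `g * h` is `h` followed by `g`.
  map_mul' g h := funext fun χ => Units.ext (multiplier_comp h.hom g.hom (hA χ.2))

lemma hom_ext_of_multiplier {A : Finset (Fin n → ℤ)} {N : ℕ} (hAN : IsAdmissible 𝕏 A N)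
    {g h : X ⟶ X} (H : ∀ χ (hχ : χ ∈ A),
      multiplier g (hAN.subset hχ) = multiplier h (hAN.subset hχ)) : g = h := by
  refine hom_ext_of_pull fun U hU => ?_
  have h1 : pull g U = pull h U := by
    refine RingHom.eq_of_eqOn_set_dense (hAN.generates strS X U hU) ?_
    rintro _ (⟨c, rfl⟩ | ⟨χ, hχ, hf⟩)
    · rw [pull_app, pull_app]
    · rw [pull_eq_multiplier_mul g (hAN.subset hχ) hf, H χ hχ, pull_eq_multiplier_mul _ _ hf]
  exact fun f => congrArg (fun φ => φ f) h1

lemma multiplierHom_injective {A : Finset (Fin n → ℤ)} {N : ℕ} (hAN : IsAdmissible 𝕏 A N) :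
    Function.Injective (X.multiplierHom hAN.subset) := by
  intro g h H
  refine Iso.ext (hom_ext_of_multiplier hAN fun χ hχ => ?_)
  exact congrArg Units.val (congrFun H ⟨χ, hχ⟩)

/-- By admissibility `f` is a combination of functions pulled back from `𝕏` with coefficients from
the base, and `g` fixes both. -/
lemma pull_eq_of_nsmul {A : Finset (Fin n → ℤ)} {N : ℕ} (hAN : IsAdmissible 𝕏 A N) (g : X ⟶ X)
    {χ : Fin n → ℤ} (hχ : χ ∈ 𝕏.saturation) {U : S.Opens} (hU : IsAffineOpen U)
    {f : Γ(X.X, X.pS ⁻¹ᵁ U)} (hf : f ∈ X.sections U (N • χ)) : pull g U f = f := by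
  have h := hAN.surjective strS X U hU χ hχ f hf
  refine (AddSubgroup.closure_le ((pull g U).toAddMonoidHom.eqLocus (AddMonoidHom.id _))).mpr ?_ h
  rintro _ ⟨c, b, -, rfl⟩
  change pull g U (_ * X.pullX U b) = _ * X.pullX U b
  rw [map_mul, pull_app, pull_pullX]

end Endomorphisms

end StableToricFamily

/-! ### Scalars by which automorphisms act on geometric fibres -/

namespace GeometricFibre

variable {k : Type u} [Field k] {n : ℕ} {𝕏 : IrredAffineTVariety k n} {S : Scheme.{u}}
  {strS : S ⟶ Spec (.of k)} {X : StableToricFamily 𝕏 strS} (F : GeometricFibre X)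

variable (X) in
lemma exists_ofPoint_point_eq (s : S) : ∃ (K : Type u) (_ : Field K) (_ : IsAlgClosed K)
    (s' : Spec (.of K) ⟶ S), (ofPoint X K s').point = s := by
  refine ⟨AlgebraicClosure (S.residueField s), inferInstance, inferInstance,
    Spec.map (CommRingCat.ofHom (algebraMap (S.residueField s)
      (AlgebraicClosure (S.residueField s)))) ≫ S.fromSpecResidueField s, ?_⟩
  exact Scheme.fromSpecResidueField_apply s _

lemma isUnit_of_value_ne_zero {U : S.Opens} {c : Γ(S, U)}
    (h : ∀ (F : GeometricFibre X) (hF : F.point ∈ U), F.value hF c ≠ 0) : IsUnit c := by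
  refine S.toRingedSpace.isUnit_of_isUnit_germ U c fun s hs => ?_
  obtain ⟨K, _, _, s', rfl⟩ := exists_ofPoint_point_eq X s
  have h1 := h (ofPoint X K s') hs
  rw [Ne, value_eq_zero_iff, not_not] at h1
  exact (S.mem_basicOpen _ _ hs).mp h1

lemma mem_top : F.point ∈ (⊤ : S.Opens) := trivial

open Classical in
/-- The value at a geometric point of the factor by which an automorphism multiplies functions of
weight `χ`. -/
def character (g : Aut X) (χ : Fin n → ℤ) : F.Kˣ := 
  if hχ : χ ∈ 𝕏.saturation then
    Units.map (F.value F.mem_top : Γ(S, ⊤) →* F.K) (Units.mk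
      (StableToricFamily.multiplier g.hom hχ) (StableToricFamily.multiplier g.inv hχ)
        (by rw [← StableToricFamily.multiplier_comp, g.inv_hom_id, StableToricFamily.multiplier_id])
        (by rw [← StableToricFamily.multiplier_comp, g.hom_inv_id,
          StableToricFamily.multiplier_id]))
  else 1

lemma coe_character (g : Aut X) {χ : Fin n → ℤ} (hχ : χ ∈ 𝕏.saturation) :
    (F.character g χ : F.K) =
      F.value F.mem_top (StableToricFamily.multiplier g.hom hχ) := by
  rw [character, dif_pos hχ]
  rfl

lemma restr_pull (g : Aut X) {χ : Fin n → ℤ} (hχ : χ ∈ 𝕏.saturation) {U : S.Opens}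
    (h : F.point ∈ U) {f : Γ(X.X, X.pS ⁻¹ᵁ U)} (hf : f ∈ X.sections U χ) :
    F.restr h (StableToricFamily.pull g.hom U f) =
      F.scalar (F.character g χ) * F.restr h f := by
  rw [StableToricFamily.pull_eq_multiplier_mul _ hχ hf, map_mul, restr_app, value_map,
    F.coe_character g hχ]

lemma zero_mem_saturation : (0 : Fin n → ℤ) ∈ 𝕏.saturation :=
  ⟨1, one_pos, by
    have := 𝕏.isIntegral
    rw [smul_zero]
    exact ⟨1, 𝕏.action.one_mem_weightSpace, one_ne_zero⟩⟩

lemma character_zero (g : Aut X) : F.character g 0 = 1 := by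
  have h := F.restr_pull g zero_mem_saturation F.mem_top X.action.one_mem_weightSpace
  rw [map_one, map_one, mul_one, ← map_one F.scalar] at h
  exact Units.ext (F.scalar_injective h).symm

/-- A function on the fibre need not extend to a neighbourhood, but one of weight `χ` is a scalar
multiple of the restriction of a local generator, which extends. -/
lemma exists_restr_evaluation_ne_zero {Z : Set F.Y} {L : Type u} [Field L] {ε : Γ(F.Y, ⊤) →+* L}
    (hε : ∀ f, ε f ≠ 0 ↔ ∃ z ∈ Z, z ∈ F.Y.basicOpen f) {χ : Fin n → ℤ}
    (hχ : χ ∈ F.action.weightSet Z) {U : S.Opens} (hU : F.point ∈ U) :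
    ∃ (V : S.Opens) (_ : V ≤ U) (hV : F.point ∈ V), ∃ f ∈ X.sections V χ,
      ε (F.restr hV f) ≠ 0 := by
  obtain ⟨V, hVU, hV, hs, e, he⟩ := X.exists_isGenerator (F.weightSet_subset Z hχ) hU
  obtain ⟨f, hf, hz⟩ := hχ
  obtain ⟨c, rfl⟩ := F.exists_eq_scalar_mul hV hs he hf
  refine ⟨V, hVU, hs, e, he.1, fun h => (hε _).mpr hz ?_⟩
  rw [map_mul, h, mul_zero]

/-- For sections of weights `χ` and `χ'` that do not vanish at the generic point of `Z`, the product
does not vanish there either. Comparing the action of `g` on the product with that on the factors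
gives the equality. -/
lemma character_add (g : Aut X) {Z : Set F.Y} (hZ : Z ∈ irreducibleComponents F.Y)
    {χ χ' : Fin n → ℤ} (hχ : χ ∈ F.action.weightSet Z) (hχ' : χ' ∈ F.action.weightSet Z) :
    F.character g (χ + χ') = F.character g χ * F.character g χ' := by
  obtain ⟨L, _, ε, hε⟩ := exists_evaluation hZ
  obtain ⟨U, -, hU, f, hf, h0⟩ := F.exists_restr_evaluation_ne_zero hε hχ F.mem_top
  obtain ⟨V, hVU, hV, f', hf', h0'⟩ := F.exists_restr_evaluation_ne_zero hε hχ' hU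
  have hf2 := X.res_mem hVU hf
  have h1 := F.restr_pull g (F.weightSet_subset Z
    ((F.action.weightSubmonoid hZ).add_mem hχ hχ')) hV (X.action.mul_mem_weightSpace hf2 hf')
  rw [map_mul, map_mul, F.restr_pull g (F.weightSet_subset Z hχ) hV hf2,
    F.restr_pull g (F.weightSet_subset Z hχ') hV hf', mul_mul_mul_comm, ← map_mul,
    ← map_mul (F.restr hV)] at h1
  refine Units.ext (F.scalar_mul_cancel (fun h => ?_) h1.symm)
  have h2 := congrArg ε h
  rw [map_mul, map_mul, map_zero, F.restr_res] at h2
  exact mul_ne_zero h0 h0' h2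

lemma restr_pullX {U : S.Opens} (h : F.point ∈ U) (b : Γ(𝕏.X, ⊤)) :
    F.restr h (X.pullX U b) = (F.ι ≫ X.pX).appTop b := by
  change (X.pX.appLE _ _ _ ≫ F.ι.appLE _ _ _) b = _
  rw [Scheme.Hom.appLE_comp_appLE, appLE_top]

lemma pullX_mem (X : StableToricFamily 𝕏 strS) (U : S.Opens) {χ : Fin n → ℤ} {b : Γ(𝕏.X, ⊤)}
    (hb : b ∈ 𝕏.action.weightSpace ⊤ χ) : X.pullX U b ∈ X.sections U χ :=
  𝕏.action.appLE_mem_weightSpace X.pX X.equivariant _ hb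

lemma mem_saturation_of_hasNonzeroImage {χ : Fin n → ℤ}
    (hχ : HasNonzeroImage 𝕏 (F.ι ≫ X.pX) χ) : χ ∈ 𝕏.saturation := by
  obtain ⟨b, hb, h0⟩ := hχ
  refine ⟨1, one_pos, b, by rwa [one_smul], ?_⟩
  rintro rfl
  exact h0 (map_zero _)

lemma character_eq_one (g : Aut X) {χ : Fin n → ℤ} (hχ : HasNonzeroImage 𝕏 (F.ι ≫ X.pX) χ) :
    F.character g χ = 1 := by
  have hs := F.mem_saturation_of_hasNonzeroImage hχ
  obtain ⟨b, hb, h0⟩ := hχ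
  have h1 := F.restr_pull g hs F.mem_top (pullX_mem X ⊤ hb)
  rw [StableToricFamily.pull_pullX, F.restr_pullX] at h1
  refine Units.ext (F.scalar_mul_cancel h0 ?_)
  rw [← h1, Units.val_one, map_one, one_mul]

end GeometricFibre

/-! ### Homomorphisms on the weight monoids as points of `Γ` -/

section Gamma

variable {k : Type u} [Field k] {n : ℕ} {𝕏 : IrredAffineTVariety k n}

lemma charEval_eq_of_isMonoidHomOn {G : Type*} [CommGroup G] {A : Finset (Fin n → ℤ)}
    (P : AddSubmonoid (Fin n → ℤ)) {Ψ : (Fin n → ℤ) → G} (h0 : Ψ 0 = 1)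
    (hadd : ∀ x ∈ P, ∀ y ∈ P, Ψ (x + y) = Ψ x * Ψ y) {m : A → ℤ}
    (hm : m ∈ subLattice A (P : Set (Fin n → ℤ))) (hP : latticeMap A m ∈ P) :
    charEval m (fun χ : A => Ψ χ) = Ψ (latticeMap A m) :=
  prod_zpow_eq_of_isMonoidHomOn P Ψ h0 hadd (fun χ : A => χ.1) m hm hP

/-- On a component, the character `m` takes the value `Ψ(α(m))` at this point whenever `α(m) ∈ Σ_Z`.
The two conditions are the cases `α(m) = 0` and `α(m) = χ`. -/
lemma mem_gammaGroup_of_isMonoidHomOn {Y : Scheme.{u}} (b : TorusAction n Y) (q : Y ⟶ 𝕏.X)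
    (A : Finset (Fin n → ℤ)) {K : Type u} [Field K] {Ψ : (Fin n → ℤ) → Kˣ} (h0 : Ψ 0 = 1)
    (hadd : ∀ Z ∈ irreducibleComponents Y, ∀ x ∈ b.weightSet Z, ∀ y ∈ b.weightSet Z,
      Ψ (x + y) = Ψ x * Ψ y)
    (hq : ∀ χ, HasNonzeroImage 𝕏 q χ → Ψ χ = 1) :
    (fun χ : A => Ψ χ) ∈ gammaGroup 𝕏 b q A K := by
  refine ⟨fun Z hZ m hm hm0 => ?_, fun χ _ hχ Z hZ hχZ m hm hmχ => ?_⟩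
  · rw [charEval_eq_of_isMonoidHomOn (b.weightSubmonoid hZ) h0 (hadd Z hZ) hm
      (by rw [hm0]; exact zero_mem _), hm0, h0]
  · rw [charEval_eq_of_isMonoidHomOn (b.weightSubmonoid hZ) h0 (hadd Z hZ) hm
      (by rw [hmχ]; exact hχZ), hmχ, hq χ hχ]

end Gamma

/-! ### The image of the automorphism group: fibrewise conditions and torsion -/

namespace StableToricFamily

variable {k : Type u} [Field k] {n : ℕ} {𝕏 : IrredAffineTVariety k n} {S : Scheme.{u}}
  {strS : S ⟶ Spec (.of k)} {X : StableToricFamily 𝕏 strS}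

lemma _root_.StableToric.GeometricFibre.coe_evalAt (F : GeometricFibre X) {ι : Type}
    (t : TorusPoints ι S) (i : ι) :
    (evalAt F.s t i : F.K) = F.value F.mem_top (t i) := by
  have := appLE_top F.s (F.top_le_preimage F.mem_top)
  change (F.s.appTop ≫ _) _ = (F.s.appLE ⊤ ⊤ _ ≫ _) _
  rw [this]

lemma _root_.StableToric.GeometricFibre.evalAt_multiplierHom (F : GeometricFibre X)
    {A : Finset (Fin n → ℤ)} (hA : (A : Set (Fin n → ℤ)) ⊆ 𝕏.saturation) (g : Aut X) :
    evalAt F.s (X.multiplierHom hA g) = fun χ : A => F.character g χ := by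
  funext χ
  refine Units.ext ?_
  rw [F.coe_evalAt, F.coe_character g (hA χ.2)]
  rfl

lemma _root_.StableToric.GeometricFibre.evalAt_multiplierHom_mem (F : GeometricFibre X)
    {A : Finset (Fin n → ℤ)} (hA : (A : Set (Fin n → ℤ)) ⊆ 𝕏.saturation) (g : Aut X) :
    evalAt F.s (X.multiplierHom hA g) ∈ gammaGroup 𝕏 F.action (F.ι ≫ X.pX) A F.K := by
  rw [F.evalAt_multiplierHom]
  exact mem_gammaGroup_of_isMonoidHomOn _ _ _ (F.character_zero g)
    (fun Z hZ x hx y hy => F.character_add g hZ hx hy) fun χ hχ => F.character_eq_one g hχ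

lemma range_multiplierHom_le {A : Finset (Fin n → ℤ)}
    (hA : (A : Set (Fin n → ℤ)) ⊆ 𝕏.saturation) :
    (X.multiplierHom hA).range ≤ X.gammaFamily A := by
  rintro _ ⟨g, rfl⟩ K _ _ s
  exact (GeometricFibre.ofPoint X K s).evalAt_multiplierHom_mem hA g

lemma nsmul_mem_saturation {χ : Fin n → ℤ} (hχ : χ ∈ 𝕏.saturation) (N : ℕ) :
    N • χ ∈ 𝕏.saturation := by
  obtain ⟨r, hr, f, hf, h0⟩ := hχ
  have := 𝕏.isIntegral
  refine ⟨r, hr, f ^ N, ?_, pow_ne_zero N h0⟩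
  rw [smul_comm]
  exact 𝕏.action.pow_mem_weightSpace hf N

lemma multiplier_pow_eq_one {A : Finset (Fin n → ℤ)} {N : ℕ} (hAN : IsAdmissible 𝕏 A N)
    (g : X ⟶ X) {χ : Fin n → ℤ} (hχ : χ ∈ 𝕏.saturation) : multiplier g hχ ^ N = 1 := by
  refine StableToric.eq_of_locally_eq fun s _ => ?_
  obtain ⟨U, -, hU, hs, e, he⟩ := X.exists_isGenerator hχ (U := ⊤) (s := s) trivial
  obtain ⟨V, hVU, hV, hsV, e', he'⟩ := X.exists_isGenerator (nsmul_mem_saturation hχ N) hs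
  refine ⟨V, le_top, hsV, ?_⟩
  have hm := X.action.pow_mem_weightSpace (he.res hVU).1 N
  obtain ⟨c, hc, -⟩ := he'.existsUnique hm
  -- If `c` vanished at a geometric point, `e ^ N` would restrict to zero on the fibre. The fibre is
  -- reduced and `e` restricts to a non-zero function, so this is impossible.
  have hu : IsUnit c := GeometricFibre.isUnit_of_value_ne_zero fun F hF h0 => by
    have h1 := congrArg (F.restr hF) hc
    rw [map_mul, F.restr_app, h0, map_zero, zero_mul, map_pow] at h1
    exact F.restr_ne_zero hV hF (he.res hVU) (eq_zero_of_pow_eq_zero h1)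
  -- Here `g` fixes `e ^ N = c e'` and also multiplies it by the `N`-th power of the multiplier;
  -- `e'` and the unit `c` cancel.
  have h1 := pull_eq_of_nsmul hAN g hχ hV hm
  rw [map_pow, pull_eq_multiplier_mul g hχ (he.res hVU).1, mul_pow, hc, ← mul_assoc, ← map_pow,
    ← map_mul] at h1
  have h2 := he'.app_mul_injective h1
  rw [map_pow, map_one]
  exact hu.mul_right_cancel (h2.trans (one_mul c).symm)

end StableToricFamily

/-! ### Construction of automorphisms -/

lemma exists_hom_of_forall_preimage {X S Y : Scheme.{u}} (p : X ⟶ S)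
    (h : ∀ U : S.affineOpens, (p ⁻¹ᵁ U.1).toScheme ⟶ Y)
    (H : ∀ (U V : S.affineOpens) (hV : V.1 ≤ U.1),
      X.homOfLE (p.preimage_mono hV) ≫ h U = h V) :
    ∃ g : X ⟶ Y, ∀ U : S.affineOpens, (p ⁻¹ᵁ U.1).ι ≫ g = h U := by
  have hc : ⨆ U : S.affineOpens, p ⁻¹ᵁ U.1 = ⊤ := by
    rw [← Scheme.Hom.preimage_iSup, iSup_affineOpens_eq_top]
    rfl
  let 𝒰 := X.openCoverOfIsOpenCover _ hc
  have key : ∀ U U' : S.affineOpens,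
      pullback.fst (p ⁻¹ᵁ U.1).ι (p ⁻¹ᵁ U'.1).ι ≫ h U =
        pullback.snd (p ⁻¹ᵁ U.1).ι (p ⁻¹ᵁ U'.1).ι ≫ h U' := by
    intro U U'
    set P := pullback (p ⁻¹ᵁ U.1).ι (p ⁻¹ᵁ U'.1).ι
    set fst : P ⟶ _ := pullback.fst (p ⁻¹ᵁ U.1).ι (p ⁻¹ᵁ U'.1).ι
    set snd : P ⟶ _ := pullback.snd (p ⁻¹ᵁ U.1).ι (p ⁻¹ᵁ U'.1).ι
    have hcond : fst ≫ (p ⁻¹ᵁ U.1).ι = snd ≫ (p ⁻¹ᵁ U'.1).ι := pullback.condition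
    -- `U ⊓ U'` need not be affine, so the overlap is covered by preimages of affine `V ≤ U ⊓ U'`.
    -- There both morphisms restrict to `h V`.
    have hP : ∀ x : P, ∃ V : {V : S.affineOpens // V.1 ≤ U.1 ⊓ U'.1},
        x ∈ (fst ≫ (p ⁻¹ᵁ U.1).ι ≫ p) ⁻¹ᵁ V.1.1 := by
      intro x
      have h1 : (fst ≫ (p ⁻¹ᵁ U.1).ι ≫ p) x ∈ U.1 ⊓ U'.1 := by
        refine ⟨(fst x).2, ?_⟩
        have : (fst ≫ (p ⁻¹ᵁ U.1).ι ≫ p) x = (snd ≫ (p ⁻¹ᵁ U'.1).ι ≫ p) x := by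
          rw [← Category.assoc, hcond, Category.assoc]
        rw [this]
        exact (snd x).2
      obtain ⟨_, ⟨V, hV, rfl⟩, hxV, hVU⟩ :=
        S.isBasis_affineOpens.exists_subset_of_mem_open h1 (U.1 ⊓ U'.1).isOpen
      exact ⟨⟨⟨V, hV⟩, hVU⟩, hxV⟩
    have hPc : ⨆ V : {V : S.affineOpens // V.1 ≤ U.1 ⊓ U'.1},
        (fst ≫ (p ⁻¹ᵁ U.1).ι ≫ p) ⁻¹ᵁ V.1.1 = ⊤ := by
      rw [eq_top_iff]
      intro x _
      rw [TopologicalSpace.Opens.mem_iSup]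
      exact hP x
    refine (P.openCoverOfIsOpenCover _ hPc).hom_ext _ _ fun V => ?_
    change ((fst ≫ (p ⁻¹ᵁ U.1).ι ≫ p) ⁻¹ᵁ V.1.1).ι ≫ fst ≫ h U =
      ((fst ≫ (p ⁻¹ᵁ U.1).ι ≫ p) ⁻¹ᵁ V.1.1).ι ≫ snd ≫ h U'
    set j := ((fst ≫ (p ⁻¹ᵁ U.1).ι ≫ p) ⁻¹ᵁ V.1.1).ι
    have hr : Set.range (j ≫ fst ≫ (p ⁻¹ᵁ U.1).ι) ⊆ Set.range (p ⁻¹ᵁ V.1.1).ι := by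
      rintro _ ⟨x, rfl⟩
      rw [Scheme.Opens.range_ι]
      exact x.2
    let l := IsOpenImmersion.lift (p ⁻¹ᵁ V.1.1).ι (j ≫ fst ≫ (p ⁻¹ᵁ U.1).ι) hr
    have hl : l ≫ (p ⁻¹ᵁ V.1.1).ι = j ≫ fst ≫ (p ⁻¹ᵁ U.1).ι := IsOpenImmersion.lift_fac _ _ _
    have h1 : l ≫ X.homOfLE (p.preimage_mono (V.2.trans inf_le_left)) = j ≫ fst := by
      rw [← cancel_mono (p ⁻¹ᵁ U.1).ι, Category.assoc, Scheme.homOfLE_ι, hl, Category.assoc]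
    have h2 : l ≫ X.homOfLE (p.preimage_mono (V.2.trans inf_le_right)) = j ≫ snd := by
      rw [← cancel_mono (p ⁻¹ᵁ U'.1).ι, Category.assoc, Scheme.homOfLE_ι, hl, Category.assoc,
        hcond]
    have h3 : l ≫ h V.1 = j ≫ fst ≫ h U :=
      (congrArg (l ≫ ·) (H U V.1 (V.2.trans inf_le_left)).symm).trans
      ((Category.assoc _ _ _).symm.trans ((congrArg (· ≫ h U) h1).trans (Category.assoc _ _ _)))
    have h4 : l ≫ h V.1 = j ≫ snd ≫ h U' :=
      (congrArg (l ≫ ·) (H U' V.1 (V.2.trans inf_le_right)).symm).trans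
      ((Category.assoc _ _ _).symm.trans ((congrArg (· ≫ h U') h2).trans (Category.assoc _ _ _)))
    exact h3.symm.trans h4
  exact ⟨𝒰.glueMorphisms h key, fun U => 𝒰.ι_glueMorphisms h key U⟩

/-- This defines a ring homomorphism by its values on generators without a presentation:
well-definedness becomes single-valuedness of the subring generated by the pairs. -/
lemma exists_ringHom_of_graph {R R' : Type*} [CommRing R] [CommRing R'] (G : Subring (R × R'))
    (hex : ∀ x, ∃ y, (x, y) ∈ G) (hu : ∀ x y y', (x, y) ∈ G → (x, y') ∈ G → y = y') :
    ∃ φ : R →+* R', ∀ x, (x, φ x) ∈ G := by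
  choose φ hφ using hex
  exact ⟨
    { toFun := φ
      map_one' := hu _ _ _ (hφ 1) G.one_mem
      map_mul' := fun x y => hu _ _ _ (hφ (x * y)) (G.mul_mem (hφ x) (hφ y))
      map_zero' := hu _ _ _ (hφ 0) G.zero_mem
      map_add' := fun x y => hu _ _ _ (hφ (x + y)) (G.add_mem (hφ x) (hφ y)) }, hφ⟩

/-! ### Translations of fibres, and detection of functions by fibres -/

namespace GeometricFibre

variable {k : Type u} [Field k] {n : ℕ} {𝕏 : IrredAffineTVariety k n} {S : Scheme.{u}}
  {strS : S ⟶ Spec (.of k)} {X : StableToricFamily 𝕏 strS} (F : GeometricFibre X)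

/-- Translation of functions on a geometric fibre by a point of the torus. -/
def translate (τ : Fin n → F.Kˣ) : Γ(F.Y, ⊤) →+* Γ(F.Y, ⊤) :=
  (laurentEval (RingHom.id _) fun i => Units.map (F.scalar : F.K →* Γ(F.Y, ⊤)) (τ i)).comp F.coact

lemma translate_of_mem (τ : Fin n → F.Kˣ) {χ : Fin n → ℤ} {f : Γ(F.Y, ⊤)}
    (hf : f ∈ F.action.weightSpace ⊤ χ) :
    F.translate τ f = f * F.scalar (charEval χ τ : F.Kˣ) := by
  rw [translate, RingHom.comp_apply, TorusAction.coaction_of_mem _ _ hf, laurentEval_single,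
    ← map_charEval]
  rfl

variable {A : Finset (Fin n → ℤ)} {N : ℕ}

/-- On the component `Z`, scaling by `t` is translation by `τ`: condition 1 factors the characters
of `ℤ^{A ∩ Σ_Z}` at `t` through `α`. For the second claim, `χ` is `α(m)` with `m ∈ ℤ^{A ∩ Σ_Z}`, and
condition 2 applies to `m`. -/
lemma exists_charEval_eq (hAN : IsAdmissible 𝕏 A N) {t : A → F.Kˣ}
    (ht : t ∈ gammaGroup 𝕏 F.action (F.ι ≫ X.pX) A F.K) {Z : Set F.Y}
    (hZ : Z ∈ irreducibleComponents F.Y) :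
    ∃ τ : Fin n → F.Kˣ, (∀ χ : A, χ.1 ∈ F.action.weightSet Z → charEval χ.1 τ = t χ) ∧
      ∀ χ ∈ F.action.weightSet Z, HasNonzeroImage 𝕏 (F.ι ≫ X.pX) χ → charEval χ τ = 1 := by
  obtain ⟨τ, hτ⟩ := exists_charEval_latticeMap A _ t (ht.1 Z hZ)
  refine ⟨τ, fun χ hχ => ?_, fun χ hχ hq => ?_⟩
  · classical
    have h1 : Pi.single χ 1 ∈ subLattice A (F.action.weightSet Z) := by
      intro χ' hχ'
      rw [Pi.single_apply, if_neg]
      rintro rfl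
      exact hχ' hχ
    have h2 : latticeMap A (Pi.single χ 1) = χ.1 := by simp [latticeMap, Pi.single_apply]
    have h3 : charEval (Pi.single χ 1) t = t χ := by
      rw [charEval, Finset.prod_eq_single χ] <;> simp +contextual
    rw [← h2, ← hτ _ h1, h3]
  · obtain ⟨m, hm, rfl⟩ := F.exists_latticeMap_eq hAN hZ hχ
    rw [← hτ m hm]
    refine ht.2 _ ?_ hq Z hZ hχ m hm rfl
    obtain ⟨b, hb, h0⟩ := hq
    exact ⟨b, hb, fun h => h0 (by rw [h, map_zero])⟩

lemma coact_restr_coeff {U : S.Opens} (hU : IsAffineOpen U) (h : F.point ∈ U)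
    (y : Γ(X.X, X.pS ⁻¹ᵁ U)) (χ : Fin n → ℤ) :
    F.restr h ((TorusAction.coaction (X.isAffineOpen_preimage hU)
      (X.isStable_preimage U) y).coeff χ) = (F.coact (F.restr h y)).coeff χ := by
  conv_rhs => rw [← TorusAction.sum_coaction_coeff (X.isAffineOpen_preimage hU)
    (X.isStable_preimage U) y]
  set c := (TorusAction.coaction (X.isAffineOpen_preimage hU) (X.isStable_preimage U) y).coeff
  have hc : ∀ m, c m ∈ X.sections U m := TorusAction.coaction_coeff_mem _ _ y
  rw [Finsupp.sum, map_sum, map_sum, AddMonoidAlgebra.coeff_sum, Finsupp.finsetSum_apply,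
    Finset.sum_eq_single χ]
  · exact (TorusAction.coaction_coeff_self _ _ _ (F.restr_mem h (hc χ))).symm
  · intro m _ hm
    exact TorusAction.coaction_coeff_of_ne _ _ _ (F.restr_mem h (hc m)) hm
  · intro hχ
    rw [Finsupp.notMem_support_iff.mp hχ]
    simp

lemma eq_zero_of_restr_eq_zero [AlgebraicGeometry.IsReduced S] {U : S.Opens}
    (hU : IsAffineOpen U) {y : Γ(X.X, X.pS ⁻¹ᵁ U)}
    (hy : ∀ s ∈ U, ∃ (F : GeometricFibre X), F.point = s ∧
      ∀ h : F.point ∈ U, F.restr h y = 0) : y = 0 := by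
  rw [← TorusAction.sum_coaction_coeff (X.isAffineOpen_preimage hU) (X.isStable_preimage U) y]
  refine Finset.sum_eq_zero fun χ _ => ?_
  set f := (TorusAction.coaction (X.isAffineOpen_preimage hU) (X.isStable_preimage U) y).coeff χ
    with hf
  have hfm : f ∈ X.sections U χ := TorusAction.coaction_coeff_mem _ _ y χ
  by_cases hχ : χ ∈ 𝕏.saturation
  swap
  · exact X.eq_zero_of_notMem hχ hfm
  refine X.eq_of_locally_eq fun s hs => ?_
  obtain ⟨V, hVU, hV, hsV, e, he⟩ := X.exists_isGenerator hχ hs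
  refine ⟨V, hVU, hsV, ?_⟩
  obtain ⟨c, hc, -⟩ := he.existsUnique (X.res_mem hVU hfm)
  -- The coefficient `c` has value zero at every point of `V`, and it is zero because `S` is
  -- reduced.
  have hc0 : c = 0 := by
    rw [← basicOpen_eq_bot_iff, eq_bot_iff]
    intro s' hs'
    have hsV' : s' ∈ V := S.basicOpen_le c hs'
    obtain ⟨F, rfl, hF⟩ := hy s' (hVU hsV')
    have h1 := F.coact_restr_coeff hU (hVU hsV') y χ
    rw [hF (hVU hsV'), map_zero, ← F.restr_res hVU hsV', ← hf, hc, map_mul, F.restr_app] at h1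
    have h2 : F.value hsV' c = 0 :=
      F.scalar_mul_cancel (F.restr_ne_zero hV hsV' he) (h1.trans (by simp))
    exact ((F.value_eq_zero_iff hsV' c).mp h2 hs').elim
  rw [hc, hc0]
  simp

end GeometricFibre

/-! ### Rescaling the functions over an affine open subset of the base -/

namespace StableToricFamily

variable {k : Type u} [Field k] {n : ℕ} {𝕏 : IrredAffineTVariety k n} {S : Scheme.{u}}
  {strS : S ⟶ Spec (.of k)} (X : StableToricFamily 𝕏 strS) {A : Finset (Fin n → ℤ)} {N : ℕ}

/-- A point of the big torus belongs to the group `Γ` of a geometric fibre over every point. -/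
def IsFibrewiseGamma (t : TorusPoints A S) : Prop :=
  ∀ s : S, ∃ F : GeometricFibre X, F.point = s ∧
    evalAt F.s t ∈ gammaGroup 𝕏 F.action (F.ι ≫ X.pX) A F.K

/-- The graph of the rescaling of the functions on the preimage of an open set by a point of the
big torus. -/
def scalingGraph (t : TorusPoints A S) (U : S.Opens) :
    Subring (Γ(X.X, X.pS ⁻¹ᵁ U) × Γ(X.X, X.pS ⁻¹ᵁ U)) :=
  Subring.closure (Set.range (fun c : Γ(S, U) => (X.pS.app U c, X.pS.app U c)) ∪
    {z | ∃ χ : A, z.1 ∈ X.sections U χ ∧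
      z.2 = X.pS.app U (resFun le_top (t χ : Γ(S, ⊤))) * z.1})

variable {X}

/-- Both sides are ring homomorphisms in `(x, y)`, so generators of the graph suffice. One of weight
`χ ∈ A` either vanishes on `Z`, or `χ ∈ Σ_Z` and `τ` scales it as `t` does. -/
lemma evaluation_restr_eq (F : GeometricFibre X) {t : TorusPoints A S} {Z : Set F.Y}
    {L : Type u} [Field L] {ε : Γ(F.Y, ⊤) →+* L}
    (hε : ∀ f, ε f ≠ 0 ↔ ∃ z ∈ Z, z ∈ F.Y.basicOpen f) {τ : Fin n → F.Kˣ}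
    (hτ : ∀ χ : A, χ.1 ∈ F.action.weightSet Z → charEval χ.1 τ = evalAt F.s t χ) {U : S.Opens}
    (h : F.point ∈ U) {x y : Γ(X.X, X.pS ⁻¹ᵁ U)} (hxy : (x, y) ∈ X.scalingGraph t U) :
    ε (F.restr h y) = ε (F.translate τ (F.restr h x)) := by
  let φ : Γ(X.X, X.pS ⁻¹ᵁ U) × Γ(X.X, X.pS ⁻¹ᵁ U) →+* L :=
    (ε.comp (F.restr h)).comp (RingHom.snd _ _)
  let ψ : Γ(X.X, X.pS ⁻¹ᵁ U) × Γ(X.X, X.pS ⁻¹ᵁ U) →+* L :=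
    ((ε.comp (F.translate τ)).comp (F.restr h)).comp (RingHom.fst _ _)
  refine (Subring.closure_le (t := φ.eqLocus ψ)).mpr ?_ hxy
  rintro ⟨x, y⟩ (⟨c, hc⟩ | ⟨χ, hx, hy⟩)
  · obtain ⟨rfl, rfl⟩ := Prod.mk.inj hc
    change ε (F.restr h (X.pS.app U c)) = ε (F.translate τ (F.restr h (X.pS.app U c)))
    rw [F.restr_app, F.translate_of_mem τ (F.scalar_mem _), charEval_zero]
    simp
  · change x ∈ _ at hx
    change y = X.pS.app U _ * x at hy
    change ε (F.restr h y) = ε (F.translate τ (F.restr h x))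
    rw [hy, map_mul, F.restr_app, F.value_map, ← F.coe_evalAt,
      F.translate_of_mem τ (F.restr_mem h hx), map_mul, map_mul, mul_comm]
    by_cases h0 : ε (F.restr h x) = 0
    · rw [h0, zero_mul, zero_mul]
    · rw [hτ χ ⟨_, F.restr_mem h hx, (hε _).mp h0⟩]

/-- Equality over the base is reduced to equality at the generic points of the components of
geometric fibres, where a translation `τ` that realizes `t` is available. -/
lemma eq_of_forall_evaluation [AlgebraicGeometry.IsReduced S] (hAN : IsAdmissible 𝕏 A N)
    {t : TorusPoints A S} (ht : X.IsFibrewiseGamma t) {U : S.Opens} (hU : IsAffineOpen U)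
    {y y' : Γ(X.X, X.pS ⁻¹ᵁ U)}
    (H : ∀ (F : GeometricFibre X) (h : F.point ∈ U) (Z : Set F.Y) (L : Type u) (_ : Field L)
      (ε : Γ(F.Y, ⊤) →+* L) (_ : ∀ f, ε f ≠ 0 ↔ ∃ z ∈ Z, z ∈ F.Y.basicOpen f)
      (τ : Fin n → F.Kˣ)
      (_ : ∀ χ : A, χ.1 ∈ F.action.weightSet Z → charEval χ.1 τ = evalAt F.s t χ)
      (_ : ∀ χ ∈ F.action.weightSet Z, HasNonzeroImage 𝕏 (F.ι ≫ X.pX) χ → charEval χ τ = 1),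
      ε (F.restr h y) = ε (F.restr h y')) : y = y' := by
  rw [← sub_eq_zero]
  refine GeometricFibre.eq_zero_of_restr_eq_zero hU fun s hs => ?_
  obtain ⟨F, rfl, hF⟩ := ht s
  refine ⟨F, rfl, fun h => eq_zero_of_evaluation fun Z hZ z hz hzf => ?_⟩
  obtain ⟨L, _, ε, hε⟩ := exists_evaluation hZ
  obtain ⟨τ, hτ, hτ'⟩ := F.exists_charEval_eq hAN hF hZ
  refine (hε _).mpr ⟨z, hz, hzf⟩ ?_
  rw [map_sub, map_sub, H F h Z L _ ε hε τ hτ hτ', sub_self]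

/-- The graph is total because `A` generates, and single-valued because on each component of a
geometric fibre `y` is a translate of `x`. -/
lemma exists_scaling [AlgebraicGeometry.IsReduced S] (hAN : IsAdmissible 𝕏 A N)
    {t : TorusPoints A S} (ht : X.IsFibrewiseGamma t) {U : S.Opens} (hU : IsAffineOpen U) :
    ∃ φ : Γ(X.X, X.pS ⁻¹ᵁ U) →+* Γ(X.X, X.pS ⁻¹ᵁ U),
      (∀ c, φ (X.pS.app U c) = X.pS.app U c) ∧
      (∀ χ : A, ∀ f ∈ X.sections U χ.1,
        φ f = X.pS.app U (resFun le_top (t χ : Γ(S, ⊤))) * f) ∧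
      ∀ b, φ (X.pullX U b) = X.pullX U b := by
  have hu : ∀ x y y', (x, y) ∈ X.scalingGraph t U → (x, y') ∈ X.scalingGraph t U → y = y' :=
    fun x y y' h h' => eq_of_forall_evaluation hAN ht hU fun F hF Z L _ ε hε τ hτ _ =>
      (evaluation_restr_eq F hε hτ hF h).trans (evaluation_restr_eq F hε hτ hF h').symm
  have happ : ∀ c, (X.pS.app U c, X.pS.app U c) ∈ X.scalingGraph t U := fun c =>
    Subring.subset_closure (Or.inl ⟨c, rfl⟩)
  have hsec : ∀ χ : A, ∀ f ∈ X.sections U χ.1,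
      (f, X.pS.app U (resFun le_top (t χ : Γ(S, ⊤))) * f) ∈ X.scalingGraph t U :=
    fun χ f hf => Subring.subset_closure (Or.inr ⟨χ, hf, rfl⟩)
  have hex : ∀ x, ∃ y, (x, y) ∈ X.scalingGraph t U := by
    have h1 : (X.scalingGraph t U).map (RingHom.fst _ _) = ⊤ := by
      rw [eq_top_iff, ← hAN.generates strS X U hU, Subring.closure_le]
      rintro _ (⟨c, rfl⟩ | ⟨χ, hχ, hf⟩)
      · exact ⟨_, happ c, rfl⟩
      · exact ⟨_, hsec ⟨χ, hχ⟩ _ hf, rfl⟩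
    intro x
    obtain ⟨⟨_, y⟩, hy, rfl⟩ := h1.ge (Subring.mem_top x)
    exact ⟨y, hy⟩
  obtain ⟨φ, hφ⟩ := exists_ringHom_of_graph _ hex hu
  refine ⟨φ, fun c => hu _ _ _ (hφ _) (happ c), fun χ f hf => hu _ _ _ (hφ _) (hsec χ f hf),
    fun b => ?_⟩
  -- The weight `χ` need not belong to `A`. On a component where the pulled back function does not
  -- vanish, the translation has `χ(τ) = 1`.
  have hw : ∀ χ, ∀ b ∈ 𝕏.action.weightSpace ⊤ χ, φ (X.pullX U b) = X.pullX U b := by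
    intro χ b hb
    refine eq_of_forall_evaluation hAN ht hU fun F hF Z L _ ε hε τ hτ hτ' => ?_
    have hm := F.restr_mem hF (GeometricFibre.pullX_mem X U hb)
    rw [evaluation_restr_eq F hε hτ hF (hφ _), F.translate_of_mem τ hm, map_mul]
    by_cases h0 : ε (F.restr hF (X.pullX U b)) = 0
    · rw [h0, zero_mul]
    · rw [hτ' χ ⟨_, hm, (hε _).mp h0⟩ ⟨b, hb, fun h => h0 (by rw [F.restr_pullX, h, map_zero])⟩]
      simp
  have := 𝕏.isAffine
  rw [← TorusAction.sum_coaction_coeff (isAffineOpen_top 𝕏.X) 𝕏.action.isStable_top b,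
    Finsupp.sum, map_sum, map_sum]
  exact Finset.sum_congr rfl fun χ _ => hw χ _ (TorusAction.coaction_coeff_mem _ _ _ _)

end StableToricFamily

/-! ### Gluing rescalings to morphisms of families -/

lemma top_le_ι_preimage {X : Scheme.{u}} (V : X.Opens) : ⊤ ≤ V.ι ⁻¹ᵁ V :=
  (Scheme.Opens.ι_preimage_self V).ge

lemma ι_appLE_injective {X : Scheme.{u}} (V : X.Opens) :
    Function.Injective (V.ι.appLE V ⊤ (top_le_ι_preimage V)) := by
  rw [Scheme.Opens.ι_appLE]
  intro f g h
  have h1 : V ≤ V.ι ''ᵁ ⊤ := (Scheme.Opens.ι_image_top V).ge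
  have h2 : ∀ f : Γ(X, V), X.presheaf.map (homOfLE h1).op
      (X.presheaf.map (homOfLE (Scheme.Opens.ι_image_top V).le).op f) = f := by
    intro f
    change (X.presheaf.map _ ≫ X.presheaf.map _) f = f
    rw [← Functor.map_comp]
    change X.presheaf.map (𝟙 _) f = f
    rw [CategoryTheory.Functor.map_id]
    rfl
  exact (h2 f).symm.trans ((congrArg (X.presheaf.map (homOfLE h1).op) h).trans (h2 g))

namespace StableToricFamily

variable {k : Type u} [Field k] {n : ℕ} {𝕏 : IrredAffineTVariety k n} {S : Scheme.{u}}
  {strS : S ⟶ Spec (.of k)} {X : StableToricFamily 𝕏 strS} {A : Finset (Fin n → ℤ)} {N : ℕ}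

lemma ringHom_ext_of_isAdmissible (hAN : IsAdmissible 𝕏 A N) {U : S.Opens} (hU : IsAffineOpen U)
    {C : Type*} [Ring C] {φ ψ : Γ(X.X, X.pS ⁻¹ᵁ U) →+* C}
    (happ : ∀ c, φ (X.pS.app U c) = ψ (X.pS.app U c))
    (hsec : ∀ χ ∈ A, ∀ f ∈ X.sections U χ, φ f = ψ f) : φ = ψ := by
  refine RingHom.eq_of_eqOn_set_dense (hAN.generates strS X U hU) ?_
  rintro _ (⟨c, rfl⟩ | ⟨χ, hχ, hf⟩)
  · exact happ c
  · exact hsec χ hχ _ hf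

/-- Into an affine target it suffices to compare two ring homomorphisms on generators. These are
weight vectors, functions from the base having weight zero, and `g` preserves their weights. -/
lemma act_comp_eq (hAN : IsAdmissible 𝕏 A N) {U : S.Opens} (hU : IsAffineOpen U)
    {g : X.X ⟶ X.X} (hg : X.pS ⁻¹ᵁ U ≤ g ⁻¹ᵁ (X.pS ⁻¹ᵁ U))
    (happ : ∀ c, g.appLE _ _ hg (X.pS.app U c) = X.pS.app U c)
    (hmem : ∀ χ ∈ A, ∀ f ∈ X.sections U χ, g.appLE _ _ hg f ∈ X.sections U χ)
    {W : Scheme.{u}} (t : TorusPoints (Fin n) W) (y : W ⟶ X.X) (hy : ⊤ ≤ y ⁻¹ᵁ (X.pS ⁻¹ᵁ U)) :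
    X.action.act t y ≫ g = X.action.act t (y ≫ g) := by
  have hs : X.action.IsStable (X.pS ⁻¹ᵁ U) := X.isStable_preimage U
  have h1 : ⊤ ≤ (X.action.act t y ≫ g) ⁻¹ᵁ (X.pS ⁻¹ᵁ U) := by
    rw [Scheme.Hom.comp_preimage]
    exact (hs t y hy).trans (Scheme.Hom.preimage_mono _ hg)
  have h2 : ⊤ ≤ (y ≫ g) ⁻¹ᵁ (X.pS ⁻¹ᵁ U) := by
    rw [Scheme.Hom.comp_preimage]
    exact hy.trans (Scheme.Hom.preimage_mono _ hg)
  have hw : ∀ χ, ∀ f ∈ X.sections U χ, g.appLE _ _ hg f ∈ X.sections U χ →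
      (X.action.act t y ≫ g).appLE (X.pS ⁻¹ᵁ U) ⊤ h1 f =
        (X.action.act t (y ≫ g)).appLE (X.pS ⁻¹ᵁ U) ⊤ (hs t _ h2) f := by
    intro χ f hf hgf
    rw [appLE_comp_apply _ _ hg (hs t y hy), hgf _ t y hy (hs t y hy),
      hf _ t (y ≫ g) h2 (hs t _ h2), appLE_comp_apply _ _ hg hy]
  refine hom_ext_of_isAffineOpen (X.isAffineOpen_preimage hU) h1 (hs t _ h2)
    (CommRingCat.hom_ext ?_)
  refine ringHom_ext_of_isAdmissible hAN hU (fun c => ?_) fun χ hχ f hf =>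
    hw χ f hf (hmem χ hχ f hf)
  have hc : X.pS.app U c ∈ X.sections U 0 := by
    have := X.smul_mem (U := U) X.action.one_mem_weightSpace c
    rwa [mul_one] at this
  exact hw 0 _ hc (by rwa [happ])

/-- An endomorphism of the total space of a family that is given over affine open subsets of the
base by ring homomorphisms preserving weights is a morphism of families. -/
lemma exists_hom_of_ringHom (hAN : IsAdmissible 𝕏 A N)
    (φ : ∀ U : S.affineOpens, Γ(X.X, X.pS ⁻¹ᵁ U.1) →+* Γ(X.X, X.pS ⁻¹ᵁ U.1))
    (happ : ∀ U c, φ U (X.pS.app U.1 c) = X.pS.app U.1 c)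
    (hmem : ∀ (U : S.affineOpens), ∀ χ ∈ A, ∀ f ∈ X.sections U.1 χ, φ U f ∈ X.sections U.1 χ)
    (hX : ∀ U b, φ U (X.pullX U.1 b) = X.pullX U.1 b)
    (hres : ∀ (U V : S.affineOpens) (h : V.1 ≤ U.1) (f : Γ(X.X, X.pS ⁻¹ᵁ U.1)),
      X.res h (φ U f) = φ V (X.res h f)) :
    ∃ g : X ⟶ X, ∀ (U : S.affineOpens) f, pull g U.1 f = φ U f := by
  let V : S.affineOpens → X.X.Opens := fun U => X.pS ⁻¹ᵁ U.1
  have hV : ∀ U, IsAffineOpen (V U) := fun U => X.isAffineOpen_preimage U.2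
  let j : ∀ U, Γ(X.X, V U) ⟶ Γ((V U).toScheme, ⊤) := fun U =>
    (V U).ι.appLE (V U) ⊤ (top_le_ι_preimage _)
  let h : ∀ U, (V U).toScheme ⟶ X.X := fun U =>
    homOfRingHom (hV U) (CommRingCat.ofHom (φ U) ≫ j U)
  have hh : ∀ U, ⊤ ≤ h U ⁻¹ᵁ V U := fun U => top_le_homOfRingHom_preimage _ _
  have hhj : ∀ U, (h U).appLE (V U) ⊤ (hh U) = CommRingCat.ofHom (φ U) ≫ j U := fun U =>
    homOfRingHom_appLE _ _ _
  have hcompat : ∀ (U U' : S.affineOpens) (hU : U'.1 ≤ U.1),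
      X.X.homOfLE (X.pS.preimage_mono hU) ≫ h U = h U' := by
    intro U U' hU
    have hle : V U' ≤ V U := X.pS.preimage_mono hU
    have h1 : ⊤ ≤ h U' ⁻¹ᵁ V U := (hh U').trans ((h U').preimage_mono hle)
    have h0 : ⊤ ≤ (X.X.homOfLE hle ≫ h U) ⁻¹ᵁ V U := by
      rw [Scheme.Hom.comp_preimage]
      exact (top_le_preimage_top _).trans ((X.X.homOfLE hle).preimage_mono (hh U))
    refine hom_ext_of_isAffineOpen (hV U) h0 h1 ?_
    rw [← Scheme.Hom.appLE_comp_appLE _ _ _ ⊤ _ (hh U) (top_le_preimage_top _), hhj]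
    have h2 : (h U').appLE (V U) ⊤ h1 =
        X.X.presheaf.map (homOfLE hle).op ≫ (h U').appLE (V U') ⊤ (hh U') := by
      rw [Scheme.Hom.map_appLE]
    have h3 : j U ≫ (X.X.homOfLE hle).appLE ⊤ ⊤ (top_le_preimage_top _) =
        X.X.presheaf.map (homOfLE hle).op ≫ j U' := by
      simp only [j]
      rw [Scheme.Hom.map_appLE, Scheme.Hom.appLE_comp_appLE]
      simp only [Scheme.homOfLE_ι]
    rw [h2, hhj, Category.assoc, h3]
    ext f
    change j U' (X.res hU (φ U f)) = j U' (φ U' (X.res hU f))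
    rw [hres]
  obtain ⟨g, hg⟩ := exists_hom_of_forall_preimage X.pS h hcompat
  have hgS : g ≫ X.pS = X.pS := by
    refine hom_ext_of_forall_preimage X.pS fun U hU => ?_
    have h1 : ⊤ ≤ (h ⟨U, hU⟩ ≫ X.pS) ⁻¹ᵁ U := hh ⟨U, hU⟩
    have h2 : ⊤ ≤ ((X.pS ⁻¹ᵁ U).ι ≫ X.pS) ⁻¹ᵁ U := top_le_ι_preimage (X.pS ⁻¹ᵁ U)
    rw [← Category.assoc, hg ⟨U, hU⟩]
    refine hom_ext_of_isAffineOpen hU h1 h2 ?_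
    rw [← Scheme.Hom.appLE_comp_appLE _ _ _ (V ⟨U, hU⟩) _ le_rfl (hh ⟨U, hU⟩),
      ← Scheme.Hom.appLE_comp_appLE _ _ _ (V ⟨U, hU⟩) _ le_rfl (top_le_ι_preimage _), hhj,
      Scheme.Hom.appLE_eq_app]
    ext c
    change j ⟨U, hU⟩ (φ ⟨U, hU⟩ (X.pS.app U c)) = j ⟨U, hU⟩ (X.pS.app U c)
    rw [happ ⟨U, hU⟩]
  have hgX : g ≫ X.pX = X.pX := by
    have := 𝕏.isAffine
    refine hom_ext_of_forall_preimage X.pS fun U hU => ?_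
    rw [← Category.assoc, hg ⟨U, hU⟩]
    refine hom_ext_of_isAffineOpen (isAffineOpen_top 𝕏.X) (top_le_preimage_top _)
      (top_le_preimage_top _) ?_
    have hle : V ⟨U, hU⟩ ≤ X.pX ⁻¹ᵁ ⊤ :=
      (show _ ≤ ⊤ from le_top).trans (top_le_preimage_top X.pX)
    rw [← Scheme.Hom.appLE_comp_appLE _ _ _ (V ⟨U, hU⟩) _ hle (hh ⟨U, hU⟩),
      ← Scheme.Hom.appLE_comp_appLE _ _ _ (V ⟨U, hU⟩) _ hle (top_le_ι_preimage _), hhj]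
    ext b
    change j ⟨U, hU⟩ (φ ⟨U, hU⟩ (X.pullX U b)) = j ⟨U, hU⟩ (X.pullX U b)
    rw [hX ⟨U, hU⟩]
  have hgle : ∀ U, V U ≤ g ⁻¹ᵁ V U := fun U => by
    change X.pS ⁻¹ᵁ U.1 ≤ g ⁻¹ᵁ (X.pS ⁻¹ᵁ U.1)
    rw [← Scheme.Hom.comp_preimage, hgS]
  have hgφ : ∀ U f, g.appLE (V U) (V U) (hgle U) f = φ U f := by
    intro U f
    refine ι_appLE_injective (V U) ?_
    have h1 : ⊤ ≤ ((V U).ι ≫ g) ⁻¹ᵁ V U := by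
      rw [hg U]
      exact hh U
    rw [← appLE_comp_apply _ _ (hgle U) (top_le_ι_preimage _) h1]
    simp only [V, hg U]
    exact congrArg (fun ψ : Γ(X.X, V U) ⟶ Γ((V U).toScheme, ⊤) => ψ f) (hhj U)
  refine ⟨⟨g, fun {W} t x => ?_, hgS, hgX⟩, hgφ⟩
  -- Equivariance is local on `W`: over the preimage of an affine `U` the point `x` lands in the
  -- preimage of `U` in the total space, where `act_comp_eq` applies.
  refine hom_ext_of_forall_preimage (x ≫ X.pS) fun U hU => ?_
  set i := ((x ≫ X.pS) ⁻¹ᵁ U).ι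
  have hx : ⊤ ≤ (i ≫ x) ⁻¹ᵁ V ⟨U, hU⟩ := top_le_ι_preimage ((x ≫ X.pS) ⁻¹ᵁ U)
  rw [← Category.assoc, X.action.comp_act, X.action.comp_act, ← Category.assoc]
  generalize i ≫ x = y at hx
  generalize TorusPoints.pull i t = t'
  refine act_comp_eq hAN hU (hgle ⟨U, hU⟩) (fun c => ?_) (fun χ hχ f hf => ?_) t' y hx
  · exact (hgφ ⟨U, hU⟩ _).trans (happ ⟨U, hU⟩ c)
  · rw [hgφ ⟨U, hU⟩]
    exact hmem ⟨U, hU⟩ χ hχ f hf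

lemma exists_hom_multiplier_eq [AlgebraicGeometry.IsReduced S] (hAN : IsAdmissible 𝕏 A N)
    {t : TorusPoints A S} (ht : X.IsFibrewiseGamma t) :
    ∃ g : X ⟶ X, ∀ χ : A, multiplier g (hAN.subset χ.2) = t χ := by
  choose φ happ hsec hX using fun U : S.affineOpens => exists_scaling hAN ht U.2
  obtain ⟨g, hg⟩ := exists_hom_of_ringHom hAN φ happ
    (fun U χ hχ f hf => by
      rw [hsec U ⟨χ, hχ⟩ f hf]
      exact X.smul_mem hf _) hX
    (fun U V h => by
      have : (X.res h).comp (φ U) = (φ V).comp (X.res h) := by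
        refine ringHom_ext_of_isAdmissible hAN U.2 (fun c => ?_) fun χ hχ f hf => ?_
        · rw [RingHom.comp_apply, RingHom.comp_apply, happ, X.res_app, happ]
        · rw [RingHom.comp_apply, RingHom.comp_apply, hsec U ⟨χ, hχ⟩ f hf, map_mul, X.res_app,
            hsec V ⟨χ, hχ⟩ _ (X.res_mem h hf), resFun_resFun]
      exact fun f => congrArg (fun ψ : _ →+* _ => ψ f) this)
  -- The multiplier is characterized over all open sets, whereas `φ` describes `g` over affine ones
  -- only; hence the passage to affine neighbourhoods.
  refine ⟨g, fun χ => eq_multiplier _ fun U f hf => X.eq_of_locally_eq fun s hs => ?_⟩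
  obtain ⟨_, ⟨V, hV, rfl⟩, hsV, hVU⟩ :=
    S.isBasis_affineOpens.exists_subset_of_mem_open hs U.isOpen
  have hVU' : V ≤ U := hVU
  refine ⟨V, hVU', hsV, ?_⟩
  rw [res_pull, hg ⟨V, hV⟩, hsec ⟨V, hV⟩ χ _ (X.res_mem hVU' hf), map_mul, X.res_app,
    resFun_resFun]

lemma IsFibrewiseGamma.inv {t : TorusPoints A S} (ht : X.IsFibrewiseGamma t) :
    X.IsFibrewiseGamma t⁻¹ := by
  intro s
  obtain ⟨F, hF, h⟩ := ht s
  exact ⟨F, hF, by rw [map_inv]; exact inv_mem h⟩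

/-- Over a reduced base, points of the big torus that belong to `Γ` on a geometric fibre over
every point come from automorphisms. -/
lemma exists_multiplierHom_eq [AlgebraicGeometry.IsReduced S] (hAN : IsAdmissible 𝕏 A N)
    {t : TorusPoints A S} (ht : X.IsFibrewiseGamma t) :
    ∃ g : Aut X, X.multiplierHom hAN.subset g = t := by
  obtain ⟨g, hg⟩ := exists_hom_multiplier_eq hAN ht
  obtain ⟨g', hg'⟩ := exists_hom_multiplier_eq hAN ht.inv
  refine ⟨⟨g, g', ?_, ?_⟩, funext fun χ => Units.ext (hg χ)⟩
  · refine hom_ext_of_multiplier hAN fun χ hχ => ?_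
    rw [multiplier_comp, multiplier_id, hg ⟨χ, hχ⟩, hg' ⟨χ, hχ⟩]
    exact (t ⟨χ, hχ⟩).inv_mul
  · refine hom_ext_of_multiplier hAN fun χ hχ => ?_
    rw [multiplier_comp, multiplier_id, hg ⟨χ, hχ⟩, hg' ⟨χ, hχ⟩]
    exact (t ⟨χ, hχ⟩).mul_inv

lemma range_multiplierHom_eq [AlgebraicGeometry.IsReduced S] (hAN : IsAdmissible 𝕏 A N) :
    (X.multiplierHom hAN.subset).range = X.gammaFamily A := by
  refine le_antisymm (range_multiplierHom_le hAN.subset) fun t ht => ?_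
  refine exists_multiplierHom_eq hAN fun s => ?_
  obtain ⟨K, _, _, s', hs'⟩ := GeometricFibre.exists_ofPoint_point_eq X s
  exact ⟨_, hs', ht K s'⟩

end StableToricFamily

/-! ### Families over the ground field -/

section GroundField

variable {k : Type u} [Field k] {n : ℕ}

lemma prod_zpow_single {ι G : Type*} [Fintype ι] [DecidableEq ι] [CommGroup G] (i : ι)
    (t : ι → G) : ∏ j, t j ^ (Pi.single i (1 : ℤ) : ι → ℤ) j = t i := by
  rw [Finset.prod_eq_single i] <;> simp +contextual

lemma charEval_latticeMap {G : Type*} [CommGroup G] (A : Finset (Fin n → ℤ)) (m : A → ℤ)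
    (τ : Fin n → G) :
    charEval (latticeMap A m) τ = charEval m fun χ : A => charEval χ.1 τ := by
  have h : latticeMap A m = ∑ χ : A, m χ • χ.1 := rfl
  change charHom τ (Multiplicative.ofAdd (latticeMap A m)) = _
  rw [h, ofAdd_sum, map_prod]
  exact Finset.prod_congr rfl fun χ _ => charEval_zsmul (m χ) χ.1 τ

lemma evalAt_id_bijective {ι : Type} :
    Function.Bijective (evalAt (ι := ι) (𝟙 (Spec (.of k)))) := by
  have hb : Function.Bijective ((Scheme.Hom.appTop (𝟙 (Spec (.of k))) ≫
      (Scheme.ΓSpecIso (.of k)).hom).hom : Γ(Spec (.of k), ⊤) →+* k) := by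
    rw [Scheme.Hom.id_appTop, Category.id_comp]
    exact (Scheme.ΓSpecIso (.of k)).commRingCatIsoToRingEquiv.bijective
  let e : Γ(Spec (.of k), ⊤) ≃+* k := RingEquiv.ofBijective _ hb
  refine ⟨fun t t' h => funext fun i => ?_, fun t => ?_⟩
  · exact Units.ext (hb.1 (congrArg Units.val (congrFun h i)))
  · refine ⟨fun i => Units.map (e.symm : k →* Γ(Spec (.of k), ⊤)) (t i), ?_⟩
    exact funext fun i => Units.ext (e.apply_symm_apply (t i : k))

namespace StableToricFamily

variable [IsAlgClosed k] {𝕏 : IrredAffineTVariety k n} (Y : StableToricFamily 𝕏 (𝟙 (Spec (.of k))))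

lemma self_restr (f : Γ(Y.X, Y.pS ⁻¹ᵁ ⊤)) :
    (GeometricFibre.self Y).restr (GeometricFibre.self Y).mem_top f = f := by
  have h : (𝟙 Y.X : Y.X ⟶ Y.X).appLE (Y.pS ⁻¹ᵁ ⊤) ⊤
      ((GeometricFibre.self Y).top_le_ι_preimage (GeometricFibre.self Y).mem_top) =
      Y.X.presheaf.map (𝟙 _) := Category.id_comp _
  change (𝟙 Y.X : Y.X ⟶ Y.X).appLE (Y.pS ⁻¹ᵁ ⊤) ⊤
      ((GeometricFibre.self Y).top_le_ι_preimage (GeometricFibre.self Y).mem_top) f = f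
  rw [h, CategoryTheory.Functor.map_id]
  rfl

lemma self_ι_comp : (GeometricFibre.self Y).ι ≫ Y.pX = Y.pX := Category.id_comp _

/-- The factor by which an automorphism of a family over the ground field multiplies functions of
weight `χ`. -/
def weightFactor (g : Aut Y) (χ : Fin n → ℤ) : kˣ := (GeometricFibre.self Y).character g χ

variable {Y}

lemma pullAut_eq_const_mul (g : Aut Y) {χ : Fin n → ℤ} (hχ : χ ∈ 𝕏.saturation)
    {f : Γ(Y.X, Y.pS ⁻¹ᵁ ⊤)} (hf : f ∈ Y.sections ⊤ χ) :
    pullAut g ⊤ f = Y.const (Y.weightFactor g χ : k) * f := by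
  have h := (GeometricFibre.self Y).restr_pull g hχ (GeometricFibre.self Y).mem_top hf
  rw [self_restr, self_restr] at h
  exact h

lemma actsBy_iff (g : Aut Y) (ψ : 𝕏.saturation → kˣ) :
    ActsBy g ψ ↔ ∀ χ : 𝕏.saturation, ψ χ = Y.weightFactor g χ.1 := by
  refine ⟨fun h χ => ?_, fun h χ f hf => by rw [h χ, pullAut_eq_const_mul g χ.2 hf]⟩
  obtain ⟨f, hf, h0⟩ := (GeometricFibre.self Y).exists_ne_zero χ.2
  have h1 := (h χ f hf).symm.trans (pullAut_eq_const_mul g χ.2 hf)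
  exact Units.ext ((GeometricFibre.self Y).scalar_mul_cancel h0 h1)

lemma evalAt_id_multiplierHom {A : Finset (Fin n → ℤ)}
    (hA : (A : Set (Fin n → ℤ)) ⊆ 𝕏.saturation) (g : Aut Y) :
    evalAt (𝟙 (Spec (.of k))) (Y.multiplierHom hA g) = fun χ : A => Y.weightFactor g χ :=
  (GeometricFibre.self Y).evalAt_multiplierHom hA g

/-- `Spec k` is reduced with a single point, and `Y` is its own geometric fibre over it, so the
construction over reduced bases applies. -/
lemma exists_weightFactor_eq {A : Finset (Fin n → ℤ)} {N : ℕ} (hAN : IsAdmissible 𝕏 A N)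
    {t : A → kˣ} (ht : t ∈ Y.gamma A) : ∃ g : Aut Y, ∀ χ : A, Y.weightFactor g χ = t χ := by
  obtain ⟨t', rfl⟩ := evalAt_id_bijective.2 t
  obtain ⟨g, rfl⟩ := exists_multiplierHom_eq hAN (X := Y) (t := t') fun s =>
    ⟨.self Y, Subsingleton.elim (α := PrimeSpectrum k) _ _, by rw [self_ι_comp]; exact ht⟩
  exact ⟨g, fun χ => (congrFun (evalAt_id_multiplierHom hAN.subset g) χ).symm⟩

lemma weightFactor_mem_gamma (g : Aut Y) {A : Finset (Fin n → ℤ)}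
    (hA : (A : Set (Fin n → ℤ)) ⊆ 𝕏.saturation) :
    (fun χ : A => Y.weightFactor g χ) ∈ Y.gamma A := by
  have h := (GeometricFibre.self Y).evalAt_multiplierHom_mem hA g
  rw [(GeometricFibre.self Y).evalAt_multiplierHom, self_ι_comp] at h
  exact h

lemma exists_actsBy (g : Aut Y) : ∃ ψ : 𝕏.saturation → kˣ, ActsBy g ψ :=
  ⟨fun χ => Y.weightFactor g χ.1, (actsBy_iff g _).mpr fun _ => rfl⟩

lemma exists_actsBy_iff {A : Finset (Fin n → ℤ)} {N : ℕ} (hAN : IsAdmissible 𝕏 A N)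
    (ψ : 𝕏.saturation → kˣ) : (∃ g : Aut Y, ActsBy g ψ) ↔
      (∀ Z ∈ irreducibleComponents Y.X, IsMonoidHomOn ψ (Y.action.weightSet Z)) ∧
      ∀ χ : 𝕏.saturation, HasNonzeroImage 𝕏 Y.pX χ.1 → ψ χ = 1 := by
  classical
  constructor
  · rintro ⟨g, hg⟩
    rw [actsBy_iff] at hg
    refine ⟨fun Z hZ => ⟨fun χ hχ => ?_, fun χ₁ χ₂ χ₃ h₁ h₂ h₃ => ?_⟩, fun χ hχ => ?_⟩
    · rw [hg, hχ]
      exact (GeometricFibre.self Y).character_zero g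
    · rw [hg, hg, hg, h₃]
      exact (GeometricFibre.self Y).character_add g hZ h₁ h₂
    · rw [hg]
      exact (GeometricFibre.self Y).character_eq_one g (by rwa [self_ι_comp])
  · rintro ⟨hmon, himg⟩
    -- The default value `1` settles `hq` outside the saturation.
    let Ψ : (Fin n → ℤ) → kˣ := fun χ => if h : χ ∈ 𝕏.saturation then ψ ⟨χ, h⟩ else 1
    have hΨ : ∀ χ : 𝕏.saturation, Ψ χ.1 = ψ χ := fun χ => dif_pos χ.2
    have hsub : ∀ Z, Y.action.weightSet Z ⊆ 𝕏.saturation := (GeometricFibre.self Y).weightSet_subset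
    obtain ⟨Z₀, hZ₀, -⟩ := (GeometricFibre.self Y).exists_mem_weightSet
      (GeometricFibre.zero_mem_saturation (𝕏 := 𝕏))
    have h0 : Ψ 0 = 1 :=
      (hΨ ⟨0, GeometricFibre.zero_mem_saturation⟩).trans ((hmon Z₀ hZ₀).1 _ rfl)
    have hadd : ∀ Z ∈ irreducibleComponents Y.X, ∀ x ∈ Y.action.weightSet Z,
        ∀ y ∈ Y.action.weightSet Z, Ψ (x + y) = Ψ x * Ψ y := by
      intro Z hZ x hx y hy
      have hxy := hsub Z ((Y.action.weightSubmonoid hZ).add_mem hx hy)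
      rw [hΨ ⟨x, hsub Z hx⟩, hΨ ⟨y, hsub Z hy⟩, hΨ ⟨x + y, hxy⟩]
      exact (hmon Z hZ).2 _ _ _ hx hy rfl
    have hq : ∀ χ, HasNonzeroImage 𝕏 Y.pX χ → Ψ χ = 1 := by
      intro χ hχ
      by_cases h : χ ∈ 𝕏.saturation
      · exact (hΨ ⟨χ, h⟩).trans (himg ⟨χ, h⟩ hχ)
      · exact dif_neg h
    obtain ⟨g, hg⟩ := exists_weightFactor_eq hAN
      (mem_gammaGroup_of_isMonoidHomOn Y.action Y.pX A h0 hadd hq)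
    refine ⟨g, (actsBy_iff g ψ).mpr fun χ => ?_⟩
    -- So far `g` acts by `ψ` on the weights in `A`. Any `χ` in the saturation is a weight of some
    -- component `Z` and equals `α(m)` with `m ∈ ℤ^{A ∩ Σ_Z}`; both `Ψ` and the factor of `g` are
    -- multiplicative on `Σ_Z`, so they agree at `χ`.
    obtain ⟨Z, hZ, hχ⟩ := (GeometricFibre.self Y).exists_mem_weightSet χ.2
    obtain ⟨m, hm, hmχ⟩ := (GeometricFibre.self Y).exists_latticeMap_eq hAN hZ hχ
    have hP : latticeMap A m ∈ Y.action.weightSubmonoid hZ := by rw [hmχ]; exact hχ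
    have h1 := charEval_eq_of_isMonoidHomOn (Y.action.weightSubmonoid hZ) h0 (hadd Z hZ) hm hP
    have h2 := charEval_eq_of_isMonoidHomOn (Y.action.weightSubmonoid hZ)
      ((GeometricFibre.self Y).character_zero g)
      (fun x hx y hy => (GeometricFibre.self Y).character_add g hZ hx hy) hm hP
    rw [hmχ] at h1 h2
    rw [← hΨ, ← h1]
    exact (congrArg (charEval m) (funext fun χ => (hg χ).symm)).trans h2

lemma exists_mulEquiv_gamma {A : Finset (Fin n → ℤ)} {N : ℕ} (hAN : IsAdmissible 𝕏 A N) :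
    ∃ e : Aut Y ≃* Y.gamma A, ∀ (g : Aut Y) (χ : A),
      (e g : A → kˣ) χ = Y.weightFactor g χ := by
  let φ : Aut Y →* (A → kˣ) := (evalAt (𝟙 (Spec (.of k)))).comp (Y.multiplierHom hAN.subset)
  have hφ : ∀ g, φ g = fun χ : A => Y.weightFactor g χ := evalAt_id_multiplierHom hAN.subset
  let φ' : Aut Y →* Y.gamma A := φ.codRestrict _ fun g => by
    rw [hφ]
    exact weightFactor_mem_gamma g hAN.subset
  have hb : Function.Bijective φ' := by
    refine ⟨fun g g' h => ?_, fun t => ?_⟩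
    · exact multiplierHom_injective hAN (evalAt_id_bijective.1 (congrArg Subtype.val h))
    · obtain ⟨g, hg⟩ := exists_weightFactor_eq hAN t.2
      exact ⟨g, Subtype.ext ((hφ g).trans (funext hg))⟩
  exact ⟨MulEquiv.ofBijective φ' hb, fun g χ => congrFun (hφ g) χ⟩

lemma kernelCondition_iff_of_irreducibleSpace [IrreducibleSpace Y.X] {A : Finset (Fin n → ℤ)}
    (hA : (A : Set (Fin n → ℤ)) ⊆ 𝕏.saturation) (t : A → kˣ) :
    KernelCondition Y.action A t ↔ ∃ τ : Fin n → kˣ, ∀ χ : A, t χ = charEval χ.1 τ := by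
  classical
  constructor
  · intro h
    have hu : Set.univ ∈ irreducibleComponents Y.X := by
      rw [irreducibleComponents_eq_singleton]
      rfl
    obtain ⟨τ, hτ⟩ := exists_charEval_latticeMap A _ t (h _ hu)
    refine ⟨τ, fun χ => ?_⟩
    -- The only component is the whole space, and every weight of `A` occurs on it, so `ℤ^{A ∩ Σ_Z}`
    -- is all of `ℤ^A`.
    have h1 : Pi.single χ 1 ∈ subLattice A (Y.action.weightSet Set.univ) := by
      intro χ' hχ'
      refine absurd ?_ hχ'
      obtain ⟨Z, hZ, hχZ⟩ := (GeometricFibre.self Y).exists_mem_weightSet (hA χ'.2)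
      obtain ⟨f, hf, z, -, hz⟩ := hχZ
      exact ⟨f, hf, z, trivial, hz⟩
    have h2 : latticeMap A (Pi.single χ 1) = χ.1 := by simp [latticeMap, Pi.single_apply]
    rw [← h2, ← hτ _ h1]
    exact (prod_zpow_single χ t).symm
  · rintro ⟨τ, hτ⟩ Z - m - hm
    obtain rfl : t = fun χ : A => charEval χ.1 τ := funext hτ
    rw [← charEval_latticeMap, hm, charEval_zero]

lemma pow_eq_one_of_mem_gamma {A : Finset (Fin n → ℤ)} {N : ℕ} (hAN : IsAdmissible 𝕏 A N)
    {t : A → kˣ} (ht : t ∈ Y.gamma A) (χ : A) : t χ ^ N = 1 := by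
  obtain ⟨g, hg⟩ := exists_weightFactor_eq hAN ht
  have h := congrArg ((GeometricFibre.self Y).value (GeometricFibre.self Y).mem_top)
    (multiplier_pow_eq_one hAN g.hom (hAN.subset χ.2))
  rw [map_pow, map_one] at h
  have h' := (GeometricFibre.self Y).coe_character g (hAN.subset χ.2)
  rw [← hg]
  refine Units.ext ?_
  rw [Units.val_pow_eq_pow_val]
  exact (congrArg (· ^ N) h').trans h

lemma charEval_nsmul_of_mem_gamma {A : Finset (Fin n → ℤ)} {N : ℕ} (hAN : IsAdmissible 𝕏 A N)
    {t : A → kˣ} (ht : t ∈ Y.gamma A) (m : A → ℤ) : charEval (N • m) t = 1 := by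
  refine Finset.prod_eq_one fun χ _ => ?_
  rw [Pi.smul_apply, nsmul_eq_mul, zpow_mul, zpow_natCast, pow_eq_one_of_mem_gamma hAN ht,
    one_zpow]

/-- All coordinates are `N`-th roots of unity, of which a field has finitely many as `N > 0`. -/
lemma finite_gamma {A : Finset (Fin n → ℤ)} {N : ℕ} (hAN : IsAdmissible 𝕏 A N) :
    Finite (Y.gamma A) := by
  have : NeZero N := ⟨hAN.pos.ne'⟩
  let f : Y.gamma A → A → rootsOfUnity N k := fun t χ =>
    ⟨t.1 χ, pow_eq_one_of_mem_gamma hAN t.2 χ⟩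
  refine Finite.of_injective f fun t t' h => Subtype.ext (funext fun χ => ?_)
  exact congrArg Subtype.val (congrFun h χ)

end StableToricFamily

end GroundField

end StableToric

end

/-! ### The theorem -/

theorem mainTheorem3 {k : Type u} [Field k] [IsAlgClosed k] [CharZero k] {n : ℕ}
    (𝕏 : StableToric.IrredAffineTVariety k n) (A : Finset (Fin n → ℤ)) (N : ℕ)
    (hAN : StableToric.IsAdmissible 𝕏 A N) :
    (∀ Y : StableToric.StableToricFamily 𝕏 (𝟙 (Spec (.of k))),
      -- automorphisms of `Y` are given by the functions `ψ` on the saturation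
      (∀ g : Aut Y, ∃ ψ : 𝕏.saturation → kˣ, StableToric.StableToricFamily.ActsBy g ψ) ∧
      (∀ ψ : 𝕏.saturation → kˣ, (∃ g : Aut Y, StableToric.StableToricFamily.ActsBy g ψ) ↔
        (∀ Z ∈ irreducibleComponents Y.X,
          StableToric.IsMonoidHomOn ψ (Y.action.weightSet Z)) ∧
        ∀ χ : 𝕏.saturation, StableToric.HasNonzeroImage 𝕏 Y.pX χ.1 → ψ χ = 1) ∧
      -- the automorphism group of `Y` is the subgroup `Γ_Y` of the big torus
      (∃ e : Aut Y ≃* Y.gamma A, ∀ (g : Aut Y) (χ : A), ∀ f ∈ Y.sections ⊤ χ.1,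
        StableToric.StableToricFamily.pullAut g ⊤ f =
          Y.const (((e g : A → kˣ) χ : kˣ) : k) * f) ∧
      -- for irreducible `Y` the first condition describes the image of `T` in the big torus
      (IrreducibleSpace Y.X → ∀ t : A → kˣ, StableToric.KernelCondition Y.action A t ↔
        ∃ τ : Fin n → kˣ, ∀ χ : A, t χ = StableToric.charEval χ.1 τ) ∧
      -- `Γ_Y` is killed by `N`, and finite
      (∀ t ∈ Y.gamma A, ∀ m : A → ℤ, StableToric.charEval (N • m) t = 1) ∧
      Finite (Y.gamma A)) ∧
    ∀ {S : Scheme.{u}} (strS : S ⟶ Spec (.of k)) (X : StableToric.StableToricFamily 𝕏 strS),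
      ∃ e : Aut X →* StableToric.TorusPoints A S, Function.Injective e ∧
        (∀ (g : Aut X) (χ : A) (U : S.Opens), ∀ f ∈ X.sections U χ.1,
          StableToric.StableToricFamily.pullAut g U f =
            X.pS.app U (S.presheaf.map (homOfLE le_top).op (e g χ : Γ(S, ⊤))) * f) ∧
        (∀ g : Aut X, e g ^ N = 1) ∧
        e.range ≤ X.gammaFamily A ∧
        (AlgebraicGeometry.IsReduced S → e.range = X.gammaFamily A) := by
  refine ⟨fun Y => ⟨StableToric.StableToricFamily.exists_actsBy,
    StableToric.StableToricFamily.exists_actsBy_iff hAN, ?_, fun h t => ?_,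
    fun t ht m => StableToric.StableToricFamily.charEval_nsmul_of_mem_gamma hAN ht m,
    StableToric.StableToricFamily.finite_gamma hAN⟩, fun {S} strS X => ?_⟩
  · obtain ⟨e, he⟩ := StableToric.StableToricFamily.exists_mulEquiv_gamma (Y := Y) hAN
    refine ⟨e, fun g χ f hf => ?_⟩
    rw [he]
    exact StableToric.StableToricFamily.pullAut_eq_const_mul g (hAN.subset χ.2) hf
  · exact StableToric.StableToricFamily.kernelCondition_iff_of_irreducibleSpace hAN.subset t
  · refine ⟨X.multiplierHom hAN.subset,
      StableToric.StableToricFamily.multiplierHom_injective hAN, fun g χ U f hf => ?_,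
      fun g => ?_, StableToric.StableToricFamily.range_multiplierHom_le hAN.subset,
      fun _ => StableToric.StableToricFamily.range_multiplierHom_eq hAN⟩
    · exact StableToric.StableToricFamily.pull_eq_multiplier_mul g.hom (hAN.subset χ.2) hf
    · refine funext fun χ => Units.ext ?_
      exact StableToric.StableToricFamily.multiplier_pow_eq_one hAN g.hom (hAN.subset χ.2)
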